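/- Let $n\ge 1$. Let $\mathfrak M(\mathbb R^n)$ be the set of Lebesgue measurable complex-valued functions on $\mathbb R^n$, and $\mathfrak M^+(\mathbb R^n)$ the set of Lebesgue measurable functions $\mathbb R^n\to[0,\infty]$. A Banach function norm is a map $\rho:\mathfrak M^+(\mathbb R^n)\to[0,\infty]$ such that, for all $f,g,f_j\in\mathfrak M^+(\mathbb R^n)$ ($j\in\mathbb N$), all constants $c\ge 0$ and all measurable $E\subset\mathbb R^n$: (A1) $\rho(f)=0\Leftrightarrow f=0$ a.e., $\rho(cf)=c\rho(f)$, $\rho(f+g)\le\rho(f)+\rho(g)$; (A2) $0\le g\le f$ a.e. implies $\rho(g)\le\rho(f)$; (A3) $0\le f_j\uparrow f$ a.e. implies $\rho(f_j)\uparrow\rho(f)$; (A4) $|E|<\infty$ implies $\rho(\chi_E)<\infty$; (A5) $|E|<\infty$ implies $\int_E f(x)\,dx\le C_E\,\rho(f)$ with a constant $C_E\in(0,\infty)$ independent of $f$. The associated Banach function space $X(\mathbb R^n)$ is the space of all $f\in\mathfrak M(\mathbb R^n)$ (modulo equality a.e.) with $\|f\|_X:=\rho(|f|)<\infty$. It has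 the weak doubling property if there is $\tau>1$ with $$\liminf_{R\to\infty}\ \inf_{y\in\mathbb R^n}\frac{\|\chi_{B(y,\tau R)}\|_X}{\|\chi_{B(y,R)}\|_X}<\infty ,$$ where $B(y,R)$ is the open Euclidean ball. Let $(Fu)(\xi)=\int_{\mathbb R^n}u(x)e^{-ix\xi}\,dx$ be the Fourier transform. For $a\in S'(\mathbb R^n)$ and $u\in S(\mathbb R^n)$, $F^{-1}aFu\in S'(\mathbb R^n)$ is defined by $\langle F^{-1}aFu,v\rangle=\langle a,(Fu)\,(F^{-1}v)\rangle$ for $v\in S(\mathbb R^n)$; for a distribution $T$, $\|T\|_X$ is $\|g\|_X$ if $T$ is given by a locally integrable function $g$, and $\infty$ otherwise. We write $a\in\mathcal M_X$ if $$\|a\|_{\mathcal M_X}:=\sup\left\{\frac{\|F^{-1}aFu\|_X}{\|u\|_X}:\ u\in\left(S(\mathbb R^n)\cap X(\mathbb R^n)\right)\setminus\{0\}\right\}<\infty .$$ **Theorem.** Let $X(\mathbb R^n)$ be a Banach function space with the weak doubling property. If $a\in\mathcal M_X\subset S'(\mathbb R^n)$, then $a\in L^\infty(\mathbb R^n)$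 (that is, $\langle a,v\rangle=\int_{\mathbb R^n} a(x)v(x)\,dx$ for all $v\in S(\mathbb R^n)$, for a function in $L^\infty(\mathbb R^n)$ again denoted by $a$), and $$\|a\|_{L^\infty(\mathbb R^n)}\le\|a\|_{\mathcal M_X}.$$ The constant $1$ on the right-hand side is best possible: for every such $X$, if $D\ge 0$ is a constant such that $\|a\|_{L^\infty(\mathbb R^n)}\le D\,\|a\|_{\mathcal M_X}$ for all $a\in\mathcal M_X$, then $D\ge 1$. -/

import Mathlib

open MeasureTheory Filter Topology
open scoped SchwartzMap ENNReal NNReal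

noncomputable section

/-- `ℝⁿ` with the Euclidean norm, scalar product and Lebesgue measure. -/
abbrev Rn (n : ℕ) : Type := EuclideanSpace ℝ (Fin n)

/-! ### Banach function spaces -/

/-- A Banach function norm `ρ` on the Lebesgue measurable functions `ℝⁿ → [0, ∞]`.
Lebesgue measurability of a `[0, ∞]`-valued function is `AEMeasurable f volume`, and Lebesgue
measurability of a set is `NullMeasurableSet E volume`. The values of `ρ` at nonmeasurable
functions are irrelevant. -/
structure BanachFunctionNorm (n : ℕ) where
  /-- the functional `ρ` -/
  toFun : (Rn n → ℝ≥0∞) → ℝ≥0∞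
  eq_zero_iff : ∀ f : Rn n → ℝ≥0∞, AEMeasurable f volume →
    (toFun f = 0 ↔ f =ᵐ[volume] 0)
  smul : ∀ (c : ℝ≥0) (f : Rn n → ℝ≥0∞), AEMeasurable f volume →
    toFun (fun x => (c : ℝ≥0∞) * f x) = (c : ℝ≥0∞) * toFun f
  add_le : ∀ f g : Rn n → ℝ≥0∞, AEMeasurable f volume → AEMeasurable g volume →
    toFun (fun x => f x + g x) ≤ toFun f + toFun g
  /-- the lattice property -/
  mono : ∀ f g : Rn n → ℝ≥0∞, AEMeasurable f volume → AEMeasurable g volume →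
    (∀ᵐ x, g x ≤ f x) → toFun g ≤ toFun f
  /-- the Fatou property -/
  fatou : ∀ (f : ℕ → Rn n → ℝ≥0∞) (g : Rn n → ℝ≥0∞),
    (∀ j, AEMeasurable (f j) volume) → AEMeasurable g volume →
    (∀ᵐ x, Monotone (fun j => f j x) ∧ Tendsto (fun j => f j x) atTop (𝓝 (g x))) →
    Monotone (fun j => toFun (f j)) ∧ Tendsto (fun j => toFun (f j)) atTop (𝓝 (toFun g))
  indicator_lt_top : ∀ E : Set (Rn n), NullMeasurableSet E volume → volume E < ∞ →
    toFun (E.indicator 1) < ∞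
  lintegral_le : ∀ E : Set (Rn n), NullMeasurableSet E volume → volume E < ∞ →
    ∃ C : ℝ≥0, 0 < C ∧ ∀ f : Rn n → ℝ≥0∞, AEMeasurable f volume →
      ∫⁻ x in E, f x ≤ (C : ℝ≥0∞) * toFun f

namespace BanachFunctionNorm

variable {n : ℕ} (X : BanachFunctionNorm n)

/-- The norm `‖f‖_X = ρ(|f|)`, with value `∞` allowed. The Banach function space `X(ℝⁿ)` consists
of the (classes of) measurable `f : ℝⁿ → ℂ` with `X.norm f < ∞`. -/
def norm (f : Rn n → ℂ) : ℝ≥0∞ := X.toFun (fun x => ‖f x‖ₑ)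

/-- `‖χ_{B(y,R)}‖_X` for the open ball `B(y,R)`. -/
def ballNorm (y : Rn n) (R : ℝ) : ℝ≥0∞ := X.norm ((Metric.ball y R).indicator 1)

/-- The weak doubling property: for some `τ > 1`,
`liminf_{R → ∞} inf_y ‖χ_{B(y,τR)}‖_X / ‖χ_{B(y,R)}‖_X < ∞`. -/
def WeakDoubling : Prop :=
  ∃ τ : ℝ, 1 < τ ∧
    liminf (fun R : ℝ => ⨅ y : Rn n, X.ballNorm y (τ * R) / X.ballNorm y R) atTop < ∞

end BanachFunctionNorm

/-! ### The Fourier transform with kernel `e^{-ixξ}` -/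

/-- The dilation `x ↦ c x` of `ℝⁿ`, for `c ≠ 0`. -/
def dilation (n : ℕ) (c : ℝ) (hc : c ≠ 0) : Rn n ≃L[ℝ] Rn n :=
  ContinuousLinearEquiv.smulLeft (Units.mk0 c hc)

/-- The Fourier transform `(Fu)(ξ) = ∫ u(x) e^{-ixξ} dx` on Schwartz functions: Mathlib's transform
(kernel `e^{-2πixξ}`) at the point `ξ / 2π`; see `schwartzF_apply`. -/
def schwartzF (n : ℕ) : 𝓢(Rn n, ℂ) →L[ℂ] 𝓢(Rn n, ℂ) :=
  (SchwartzMap.compCLMOfContinuousLinearEquiv ℂ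
    (dilation n (2 * Real.pi)⁻¹ (inv_ne_zero Real.two_pi_pos.ne'))).comp
  (FourierTransform.fourierCLM ℂ 𝓢(Rn n, ℂ))

/-- The inverse of `schwartzF`, i.e. `(F⁻¹v)(x) = (2π)⁻ⁿ ∫ v(ξ) e^{ixξ} dξ`; see
`schwartzFInv_apply`. -/
def schwartzFInv (n : ℕ) : 𝓢(Rn n, ℂ) →L[ℂ] 𝓢(Rn n, ℂ) :=
  (FourierTransform.fourierInvCLM ℂ 𝓢(Rn n, ℂ)).comp
  (SchwartzMap.compCLMOfContinuousLinearEquiv ℂ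
    (dilation n (2 * Real.pi) Real.two_pi_pos.ne'))

theorem schwartzF_apply (n : ℕ) (u : 𝓢(Rn n, ℂ)) (ξ : Rn n) :
    schwartzF n u ξ = ∫ x, u x * Complex.exp (-(Complex.I * (inner ℝ x ξ : ℝ))) := by
  have h : schwartzF n u ξ =
      FourierTransform.fourier (u : Rn n → ℂ) ((2 * Real.pi)⁻¹ • ξ) := by
    rw [← SchwartzMap.fourier_coe]; rfl
  rw [h, Real.fourier_eq']
  refine integral_congr_ae (Eventually.of_forall fun x => ?_)
  have hp : (Real.pi : ℂ) ≠ 0 := by exact_mod_cast Real.pi_ne_zero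
  simp only [smul_eq_mul, inner_smul_right]
  rw [mul_comm]
  congr 2
  push_cast
  field_simp

theorem schwartzFInv_apply (n : ℕ) (v : 𝓢(Rn n, ℂ)) (x : Rn n) :
    schwartzFInv n v x =
      ((2 * Real.pi) ^ n)⁻¹ * ∫ ξ, v ξ * Complex.exp (Complex.I * (inner ℝ x ξ : ℝ)) := by
  have h : schwartzFInv n v x =
      FourierTransform.fourierInv (fun ξ : Rn n => v ((2 * Real.pi) • ξ)) x := by
    change (FourierTransform.fourierInv (SchwartzMap.compCLMOfContinuousLinearEquiv ℂ
      (dilation n (2 * Real.pi) Real.two_pi_pos.ne') v)) x = _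
    rw [SchwartzMap.fourierInv_coe]; rfl
  rw [h, Real.fourierInv_eq']
  have hpos : (0 : ℝ) ≤ 2 * Real.pi := Real.two_pi_pos.le
  have key := Measure.integral_comp_smul_of_nonneg (volume : Measure (Rn n))
    (fun ξ : Rn n => v ξ * Complex.exp (Complex.I * (inner ℝ x ξ : ℝ))) (2 * Real.pi) (hR := hpos)
  rw [finrank_euclideanSpace_fin, Complex.real_smul] at key
  push_cast at key ⊢
  rw [← key]
  refine integral_congr_ae (Eventually.of_forall fun ξ => ?_)
  simp only [smul_eq_mul, inner_smul_right]
  rw [mul_comm, real_inner_comm]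
  congr 2
  push_cast
  ring

theorem schwartzFInv_schwartzF (n : ℕ) (u : 𝓢(Rn n, ℂ)) :
    schwartzFInv n (schwartzF n u) = u := by
  have h : SchwartzMap.compCLMOfContinuousLinearEquiv ℂ
      (dilation n (2 * Real.pi) Real.two_pi_pos.ne') (schwartzF n u) =
      FourierTransform.fourier u := by
    ext ξ
    change FourierTransform.fourier u ((2 * Real.pi)⁻¹ • ((2 * Real.pi) • ξ)) = _
    rw [inv_smul_smul₀ Real.two_pi_pos.ne']
  change FourierTransform.fourierInv (SchwartzMap.compCLMOfContinuousLinearEquiv ℂ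
      (dilation n (2 * Real.pi) Real.two_pi_pos.ne') (schwartzF n u)) = u
  rw [h, FourierTransform.fourierInv_fourier_eq]

/-- The inverse Fourier transform on tempered distributions, `⟨F⁻¹T, v⟩ = ⟨T, F⁻¹v⟩`. -/
def temperedFInv (n : ℕ) : 𝓢'(Rn n, ℂ) →L[ℂ] 𝓢'(Rn n, ℂ) :=
  PointwiseConvergenceCLM.precomp ℂ (schwartzFInv n)

/-- The tempered distribution `F⁻¹ a F u`, for a symbol `a ∈ S'(ℝⁿ)` and `u ∈ S(ℝⁿ)`. -/
def fourierMult {n : ℕ} (a : 𝓢'(Rn n, ℂ)) (u : 𝓢(Rn n, ℂ)) : 𝓢'(Rn n, ℂ) :=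
  temperedFInv n (TemperedDistribution.smulLeftCLM ℂ (schwartzF n u : Rn n → ℂ) a)

/-! ### Fourier multipliers on a Banach function space -/

/-- The tempered distribution `T` is the locally integrable function `g`, as elements of
`𝓓'(ℝⁿ)`: `⟨T, v⟩ = ∫ g v` for all `v ∈ C₀^∞(ℝⁿ)`. -/
def IsRepresentedBy {n : ℕ} (T : 𝓢'(Rn n, ℂ)) (g : Rn n → ℂ) : Prop :=
  LocallyIntegrable g volume ∧
    ∀ v : 𝓢(Rn n, ℂ), HasCompactSupport v → T v = ∫ x, g x * v x

namespace BanachFunctionNorm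

variable {n : ℕ} (X : BanachFunctionNorm n)

/-- The `X`-norm of a tempered distribution: the norm of the locally integrable function
representing it (which is unique a.e.), and `∞` if there is none. -/
def distNorm (T : 𝓢'(Rn n, ℂ)) : ℝ≥0∞ :=
  ⨅ (g : Rn n → ℂ) (_ : IsRepresentedBy T g), X.norm g

/-- The multiplier norm `‖a‖_{𝓜_X}`, with value `∞` allowed: the supremum of
`‖F⁻¹aFu‖_X / ‖u‖_X` over all nonzero `u ∈ S(ℝⁿ) ∩ X(ℝⁿ)`. -/
def multNorm (a : 𝓢'(Rn n, ℂ)) : ℝ≥0∞ :=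
  ⨆ (u : 𝓢(Rn n, ℂ)) (_ : u ≠ 0) (_ : X.norm u < ∞), X.distNorm (fourierMult a u) / X.norm u

/-- `a ∈ 𝓜_X`: the distribution `a` is a Fourier multiplier on `X(ℝⁿ)`. -/
def IsFourierMultiplier (a : 𝓢'(Rn n, ℂ)) : Prop := X.multNorm a < ∞

end BanachFunctionNorm

end

/-! The core is the estimate `|⟨b, 𝓕w⟩| ≤ M ∫ |𝓕w|`, where `b` is the symbol rescaled to the kernel
`e^{-2πixξ}` and `M` is the multiplier norm. The operator `𝓕⁻ b 𝓕` sends `u` to the continuous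
function `x ↦ ⟨b, 𝓕(u(· + x))⟩` (`multFun`). Modulating `u` by a frequency `η` keeps `|u|`, hence
`‖u‖_X`, and shifts `𝓕(u(· + x))` by `η` up to a unimodular factor. Averaging over `η` against `𝓕w`
and using Minkowski's inequality, the function `x ↦ ⟨b, 𝓕w * 𝓕(u(· + x))⟩` has `X`-norm at most `M
‖u‖_X ∫ |𝓕w|` (`norm_apply_conv_le`).

Let `w` vanish outside a ball of radius `r` about `0`, and let `u` be a smooth cutoff, `1` on `B(y,
R + r)` and `0` off `B(y, σR)`. For `x ∈ B(y, R)` one has `w · u(· + x) = w`, so `𝓕w * 𝓕(u(· + x)) =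
𝓕w` and the function above is constant on that ball. Therefore `|⟨b, 𝓕w⟩| ‖χ_{B(y,R)}‖ ≤ M
‖χ_{B(y,σR)}‖ ∫ |𝓕w|`. Weak doubling improves itself: for any `θ > 1` some `σ > 1` makes the
quotient of the two ball norms at most `θ` for suitable `y` and arbitrarily large `R`
(`WeakDoubling.exists_ballNorm_le`). Letting `θ → 1` gives the constant `1`.

Density of compactly supported functions extends the estimate to all Schwartz functions, and `L¹`
duality turns it into a bounded density (`exists_Lp_top_of_norm_apply_le`). The symbol `1` acts as
the identity, which makes the constant optimal. -/

open scoped LineDeriv FourierTransform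

/-! ### Translations of Schwartz functions -/

namespace SchwartzMap

section Translation

variable {E F : Type*} [NormedAddCommGroup E] [NormedSpace ℝ E] [NormedAddCommGroup F]
  [NormedSpace ℝ F] [NormedSpace ℂ F]

theorem tendsto_nhds_iff_seminorm {ι : Type*} {l : Filter ι} {f : ι → 𝓢(E, F)} {g : 𝓢(E, F)} :
    Tendsto f l (𝓝 g) ↔
      ∀ k m : ℕ, Tendsto (fun i => SchwartzMap.seminorm ℂ k m (f i - g)) l (𝓝 0) := by
  rw [(schwartz_withSeminorms ℂ E F).tendsto_nhds]
  simp only [schwartzSeminormFamily, Prod.forall, Metric.tendsto_nhds, dist_zero_right,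
    Real.norm_of_nonneg (apply_nonneg _ _)]

theorem iteratedFDeriv_compSubConstCLM (f : 𝓢(E, F)) (a x : E) (m : ℕ) :
    iteratedFDeriv ℝ m (f.compSubConstCLM ℂ a) x = iteratedFDeriv ℝ m f (x - a) :=
  iteratedFDeriv_comp_sub m a x

theorem exists_one_add_norm_pow_mul_le (f : 𝓢(E, F)) (k m : ℕ) :
    ∃ C, 0 ≤ C ∧ ∀ x, (1 + ‖x‖) ^ k * ‖iteratedFDeriv ℝ m f x‖ ≤ C :=
  ⟨_, by positivity, fun x => one_add_le_sup_seminorm_apply (𝕜 := ℂ) (m := (k, m)) le_rfl le_rfl f x⟩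

/-- Follows from `1 + ‖x‖ ≤ (1 + ‖a‖)(1 + ‖x - a‖)`. This polynomial growth in `a` is what supplies
the dominating functions for integrals over translates. -/
theorem exists_seminorm_compSubConstCLM_le (f : 𝓢(E, F)) (k m : ℕ) :
    ∃ C, 0 ≤ C ∧ ∀ a, SchwartzMap.seminorm ℂ k m (f.compSubConstCLM ℂ a) ≤
      C * (1 + ‖a‖) ^ k := by
  obtain ⟨C, hC, h⟩ := exists_one_add_norm_pow_mul_le f k m
  refine ⟨C, hC, fun a => seminorm_le_bound ℂ k m _ (by positivity) fun x => ?_⟩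
  rw [iteratedFDeriv_compSubConstCLM]
  have h1 : ‖x‖ ≤ (1 + ‖a‖) * (1 + ‖x - a‖) := by
    have := norm_le_norm_sub_add x a
    nlinarith [norm_nonneg a, norm_nonneg (x - a)]
  calc ‖x‖ ^ k * ‖iteratedFDeriv ℝ m f (x - a)‖
      ≤ ((1 + ‖a‖) * (1 + ‖x - a‖)) ^ k * ‖iteratedFDeriv ℝ m f (x - a)‖ := by gcongr
    _ = ((1 + ‖x - a‖) ^ k * ‖iteratedFDeriv ℝ m f (x - a)‖) * (1 + ‖a‖) ^ k := by
      rw [mul_pow]; ring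
    _ ≤ C * (1 + ‖a‖) ^ k := by gcongr; exact h _

/-- The mean value inequality on the segment from `x` to `x - a` costs one derivative; for `‖a‖ ≤ 1`
the weights at points of the segment are comparable up to the factor `2 ^ k`. -/
theorem tendsto_compSubConstCLM_zero (f : 𝓢(E, F)) :
    Tendsto (fun a => f.compSubConstCLM ℂ a) (𝓝 0) (𝓝 f) := by
  refine tendsto_nhds_iff_seminorm.2 fun k m => ?_
  obtain ⟨C, hC, h⟩ := exists_one_add_norm_pow_mul_le f k (m + 1)
  have key : ∀ a : E, ‖a‖ ≤ 1 →
      SchwartzMap.seminorm ℂ k m (f.compSubConstCLM ℂ a - f) ≤ 2 ^ k * C * ‖a‖ := by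
    intro a ha
    refine seminorm_le_bound ℂ k m _ (by positivity) fun x => ?_
    have hd : iteratedFDeriv ℝ m (f.compSubConstCLM ℂ a - f) x =
        iteratedFDeriv ℝ m f (x - a) - iteratedFDeriv ℝ m f x := by
      rw [← iteratedFDeriv_compSubConstCLM]
      exact iteratedFDeriv_sub_apply ((f.compSubConstCLM ℂ a).contDiffAt m) (f.contDiffAt m)
    rw [hd]
    have hx : (0 : ℝ) < (1 + ‖x‖) ^ k := by positivity
    have hb : ∀ z ∈ segment ℝ x (x - a), ‖fderiv ℝ (iteratedFDeriv ℝ m f) z‖ ≤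
        2 ^ k * C / (1 + ‖x‖) ^ k := by
      intro z hz
      rw [norm_fderiv_iteratedFDeriv, le_div_iff₀ hx]
      have hzx : ‖x - z‖ ≤ 1 := by
        have := norm_sub_le_of_mem_segment hz
        rw [norm_sub_rev]
        refine this.trans ?_
        simpa using ha
      have : 1 + ‖x‖ ≤ 2 * (1 + ‖z‖) := by
        have := norm_le_norm_sub_add x z
        linarith [norm_nonneg z]
      calc ‖iteratedFDeriv ℝ (m + 1) f z‖ * (1 + ‖x‖) ^ k
          ≤ ‖iteratedFDeriv ℝ (m + 1) f z‖ * (2 * (1 + ‖z‖)) ^ k := by gcongr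
        _ = 2 ^ k * ((1 + ‖z‖) ^ k * ‖iteratedFDeriv ℝ (m + 1) f z‖) := by rw [mul_pow]; ring
        _ ≤ 2 ^ k * C := by gcongr; exact h z
    have hdiff : ∀ z ∈ segment ℝ x (x - a), DifferentiableAt ℝ (iteratedFDeriv ℝ m f) z :=
      fun z _ => (f.smooth ⊤).differentiable_iteratedFDeriv (mod_cast ENat.natCast_lt_top m) z
    have hmv := (convex_segment x (x - a)).norm_image_sub_le_of_norm_fderiv_le hdiff hb
      (left_mem_segment ℝ x (x - a)) (right_mem_segment ℝ x (x - a))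
    have hxa : ‖x - a - x‖ = ‖a‖ := by simp
    rw [hxa] at hmv
    calc ‖x‖ ^ k * ‖iteratedFDeriv ℝ m f (x - a) - iteratedFDeriv ℝ m f x‖
        ≤ (1 + ‖x‖) ^ k * (2 ^ k * C / (1 + ‖x‖) ^ k * ‖a‖) := by
          gcongr
          linarith [norm_nonneg x]
      _ = 2 ^ k * C * ‖a‖ := by field_simp
  have hlim : Tendsto (fun a : E => 2 ^ k * C * ‖a‖) (𝓝 0) (𝓝 0) := by
    have : Continuous fun a : E => 2 ^ k * C * ‖a‖ := by fun_prop
    simpa using this.tendsto 0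
  refine squeeze_zero' (Eventually.of_forall fun a => apply_nonneg _ _) ?_ hlim
  filter_upwards [Metric.closedBall_mem_nhds (0 : E) one_pos] with a ha
  exact key a (by simpa using ha)

theorem continuous_compSubConstCLM (f : 𝓢(E, F)) :
    Continuous fun a => f.compSubConstCLM ℂ a := by
  refine continuous_iff_continuousAt.2 fun a => ?_
  have h1 : Tendsto (fun b : E => b - a) (𝓝 a) (𝓝 0) := by
    have : Continuous fun b : E => b - a := by fun_prop
    simpa using this.tendsto a
  have h2 := ((compSubConstCLM ℂ a (E := E) (F := F)).continuous.tendsto f).comp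
    ((tendsto_compSubConstCLM_zero f).comp h1)
  refine h2.congr fun b => ?_
  simp

end Translation

/-! ### Convolution and its derivatives -/

section Convolution

variable {E : Type*} [NormedAddCommGroup E] [InnerProductSpace ℝ E] [FiniteDimensional ℝ E]
  [MeasurableSpace E] [BorelSpace E]

/-- The convolution of scalar Schwartz functions. -/
noncomputable abbrev conv (f g : 𝓢(E, ℂ)) : 𝓢(E, ℂ) :=
  convolution (ContinuousLinearMap.mul ℂ ℂ) f g

theorem conv_apply (f g : 𝓢(E, ℂ)) (x : E) : conv f g x = ∫ t, f t * g (x - t) := by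
  rw [conv, convolution_apply]
  rfl

/-- On the Fourier side `∂_m` is multiplication by `2πi⟨·, m⟩`, which may be attached to the factor
`𝓕 g` alone. -/
theorem lineDerivOp_conv (f g : 𝓢(E, ℂ)) (m : E) : ∂_{m} (conv f g) = conv f (∂_{m} g) := by
  have hm : (fun x : E => inner ℝ x m).HasTemperateGrowth := by fun_prop
  simp only [conv, convolution, LinearMap.coe_mk, AddHom.coe_mk,
    ContinuousLinearMap.coe_comp, Function.comp_apply, FourierTransform.fourierInvCLM_apply,
    FourierTransform.fourierCLM_apply, lineDerivOp_fourierInv_eq, fourier_lineDerivOp_eq]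
  congr 1
  ext x
  simp [hm]
  ring

theorem iteratedLineDerivOp_conv (f g : 𝓢(E, ℂ)) {l : ℕ} (m : Fin l → E) :
    ∂^{m} (conv f g) = conv f (∂^{m} g) := by
  induction l with
  | zero => simp
  | succ l ih => rw [LineDeriv.iteratedLineDerivOp_succ_left, ih, lineDerivOp_conv,
      ← LineDeriv.iteratedLineDerivOp_succ_left]

theorem iteratedFDeriv_conv_apply (f g : 𝓢(E, ℂ)) (l : ℕ) (x : E) (m : Fin l → E) :
    iteratedFDeriv ℝ l (conv f g) x m = ∫ t, f t * iteratedFDeriv ℝ l g (x - t) m := by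
  rw [← iteratedLineDerivOp_eq_iteratedFDeriv, iteratedLineDerivOp_conv, conv_apply]
  simp_rw [iteratedLineDerivOp_eq_iteratedFDeriv]

end Convolution

end SchwartzMap

/-! ### Convolutions as limits of Riemann sums in the Schwartz topology -/

theorem MeasureTheory.SimpleFunc.sum_setIntegral_mul {α β : Type*} [MeasurableSpace α]
    {μ : Measure α} {v : α → ℂ} (hv : Integrable v μ) (s : SimpleFunc α β) (Φ : β → ℂ) :
    Integrable (fun t => v t * Φ (s t)) μ ∧
      ∑ k ∈ s.range, (∫ t in s ⁻¹' {k}, v t ∂μ) * Φ k = ∫ t, v t * Φ (s t) ∂μ := by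
  classical
  have h : (fun t => v t * Φ (s t)) =
      fun t => ∑ k ∈ s.range, (s ⁻¹' {k}).indicator v t * Φ k := by
    funext t
    rw [Finset.sum_eq_single (s t)]
    · simp
    · intro k _ hk
      simp [hk.symm]
    · intro ht
      exact absurd (s.mem_range_self t) ht
  have hi : ∀ k ∈ s.range, Integrable (fun t => (s ⁻¹' {k}).indicator v t * Φ k) μ :=
    fun k _ => (hv.indicator (s.measurableSet_fiber k)).mul_const _
  rw [h]
  refine ⟨integrable_finsetSum _ hi, ?_⟩
  rw [integral_finsetSum _ hi]
  refine Finset.sum_congr rfl fun k _ => ?_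
  rw [integral_mul_const, integral_indicator (s.measurableSet_fiber k)]

namespace SchwartzMap

variable {E : Type*} [NormedAddCommGroup E] [InnerProductSpace ℝ E] [FiniteDimensional ℝ E]
  [MeasurableSpace E] [BorelSpace E]

/-- The finite linear combination of translates of `g` that approximates `conv f g` when the simple
function `s` approximates the identity. -/
noncomputable def riemannSum (f g : 𝓢(E, ℂ)) (s : SimpleFunc E E) : 𝓢(E, ℂ) :=
  ∑ k ∈ s.range, (∫ t in s ⁻¹' {k}, f t) • g.compSubConstCLM ℂ k

/-- Simple functions converging to the identity of `E`. -/
noncomputable def simpleId (E : Type*) [NormedAddCommGroup E] [InnerProductSpace ℝ E]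
    [FiniteDimensional ℝ E] [MeasurableSpace E] [BorelSpace E] (j : ℕ) : SimpleFunc E E :=
  SimpleFunc.approxOn id measurable_id Set.univ 0 (Set.mem_univ 0) j

theorem tendsto_simpleId (t : E) : Tendsto (fun j => simpleId E j t) atTop (𝓝 t) :=
  SimpleFunc.tendsto_approxOn measurable_id (Set.mem_univ 0) (by simp)

theorem norm_simpleId_le (j : ℕ) (t : E) : ‖simpleId E j t‖ ≤ 2 * ‖t‖ := by
  have := SimpleFunc.norm_approxOn_zero_le (f := (id : E → E)) measurable_id (Set.mem_univ 0) t j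
  rw [two_mul]
  exact this

theorem integrable_norm_mul_one_add_norm_pow (f : 𝓢(E, ℂ)) (k : ℕ) :
    Integrable (fun t => ‖f t‖ * (1 + ‖t‖) ^ k) := by
  have h : (fun t : E => ‖f t‖ * (1 + ‖t‖) ^ k) =
      fun t => ∑ i ∈ Finset.range (k + 1), (k.choose i : ℝ) * (‖t‖ ^ i * ‖f t‖) := by
    funext t
    rw [add_comm, add_pow, Finset.mul_sum]
    refine Finset.sum_congr rfl fun i _ => ?_
    simp
    ring
  rw [h]
  exact integrable_finsetSum _ fun i _ => (f.integrable_pow_mul volume i).const_mul _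

theorem iteratedFDeriv_riemannSum_apply (f g : 𝓢(E, ℂ)) (s : SimpleFunc E E) (l : ℕ) (x : E)
    (m : Fin l → E) :
    iteratedFDeriv ℝ l (riemannSum f g s) x m =
      ∑ k ∈ s.range, (∫ t in s ⁻¹' {k}, f t) * iteratedFDeriv ℝ l g (x - k) m := by
  simp only [← iteratedLineDerivOp_eq_iteratedFDeriv]
  have : ∂^{m} (riemannSum f g s) =
      ∑ k ∈ s.range, (∫ t in s ⁻¹' {k}, f t) • ∂^{m} (g.compSubConstCLM ℂ k) := by
    rw [riemannSum, ← LineDeriv.iteratedLineDerivOpCLM_apply (R := ℂ), map_sum]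
    simp
  rw [this, sum_apply]
  refine Finset.sum_congr rfl fun k _ => ?_
  simp [iteratedLineDerivOp_eq_iteratedFDeriv, iteratedFDeriv_compSubConstCLM]

/-- Every derivative of the difference is a single integral of `f t` against the derivative of `g(·
- s t) - g(· - t)`, so the seminorm passes under the integral pointwise in `x`. -/
theorem seminorm_riemannSum_sub_conv_le (f g : 𝓢(E, ℂ)) (s : SimpleFunc E E) (k l : ℕ)
    (hint : Integrable fun t => ‖f t‖ * SchwartzMap.seminorm ℂ k l
      (g.compSubConstCLM ℂ (s t) - g.compSubConstCLM ℂ t)) :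
    SchwartzMap.seminorm ℂ k l (riemannSum f g s - conv f g) ≤
      ∫ t, ‖f t‖ * SchwartzMap.seminorm ℂ k l
        (g.compSubConstCLM ℂ (s t) - g.compSubConstCLM ℂ t) := by
  have hnn : ∀ t, 0 ≤ ‖f t‖ * SchwartzMap.seminorm ℂ k l
      (g.compSubConstCLM ℂ (s t) - g.compSubConstCLM ℂ t) := fun t => by positivity
  refine seminorm_le_bound ℂ k l _ (integral_nonneg hnn) fun x => ?_
  rcases (pow_nonneg (norm_nonneg x) k).eq_or_lt with h0 | hx
  · rw [← h0, zero_mul]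
    exact integral_nonneg hnn
  rw [← le_div_iff₀' hx]
  refine ContinuousMultilinearMap.opNorm_le_bound (div_nonneg (integral_nonneg hnn) hx.le)
    fun m => ?_
  have hsub : ∀ u w : 𝓢(E, ℂ), iteratedFDeriv ℝ l (u - w) x =
      iteratedFDeriv ℝ l u x - iteratedFDeriv ℝ l w x := fun u w =>
    iteratedFDeriv_sub_apply (u.contDiffAt l) (w.contDiffAt l)
  have hfi : Integrable (f : E → ℂ) := f.integrable
  obtain ⟨hi1, hs⟩ := s.sum_setIntegral_mul hfi fun k => iteratedFDeriv ℝ l g (x - k) m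
  have hi2 : Integrable fun t => f t * iteratedFDeriv ℝ l g (x - t) m := by
    obtain ⟨C, hC⟩ : ∃ C, ∀ y, ‖(∂^{m} g) y‖ ≤ C :=
      ⟨_, fun y => norm_le_seminorm ℂ (∂^{m} g) y⟩
    simp_rw [← iteratedLineDerivOp_eq_iteratedFDeriv]
    refine hfi.mul_bdd (c := C) ?_ (Eventually.of_forall fun t => hC _)
    exact ((∂^{m} g).continuous.comp (continuous_const.sub continuous_id)).aestronglyMeasurable
  rw [hsub, sub_apply, iteratedFDeriv_riemannSum_apply,
    iteratedFDeriv_conv_apply, hs, ← integral_sub hi1 hi2]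
  refine (norm_integral_le_integral_norm _).trans ?_
  rw [div_mul_eq_mul_div, ← integral_mul_const, ← integral_div]
  refine integral_mono (hi1.sub hi2).norm ((hint.mul_const _).div_const _) fun t => ?_
  change ‖f t * _ - f t * _‖ ≤ ‖f t‖ * _ * _ / _
  rw [← mul_sub, norm_mul, mul_assoc, mul_div_assoc]
  gcongr
  rw [← sub_apply, le_div_iff₀' hx, ← iteratedFDeriv_compSubConstCLM,
    ← iteratedFDeriv_compSubConstCLM, ← hsub]
  calc _ ≤ ‖x‖ ^ k * (‖iteratedFDeriv ℝ l
        (g.compSubConstCLM ℂ (s t) - g.compSubConstCLM ℂ t) x‖ * ∏ i, ‖m i‖) := by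
        gcongr
        exact ContinuousMultilinearMap.le_opNorm _ _
    _ ≤ _ := by
        rw [← mul_assoc]
        gcongr
        exact le_seminorm ℂ k l _ x

theorem tendsto_riemannSum (f g : 𝓢(E, ℂ)) :
    Tendsto (fun j => riemannSum f g (simpleId E j)) atTop (𝓝 (conv f g)) := by
  refine tendsto_nhds_iff_seminorm.2 fun k l => ?_
  obtain ⟨C, hC, hb⟩ := exists_seminorm_compSubConstCLM_le g k l
  set p := SchwartzMap.seminorm ℂ k l (E := E) (F := ℂ) with hp
  have hpc : Continuous p := (schwartz_withSeminorms ℂ E ℂ).continuous_seminorm (k, l)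
  -- The factor `2 ^ k` comes from `‖simpleId E j t‖ ≤ 2 ‖t‖`; the bound is independent of `j`, as
  -- dominated convergence requires.
  have hbound : ∀ j t, ‖f t‖ * p (g.compSubConstCLM ℂ (simpleId E j t) - g.compSubConstCLM ℂ t) ≤
      (C * 2 ^ k + C) * (‖f t‖ * (1 + ‖t‖) ^ k) := by
    intro j t
    have h1 := map_sub_le_add p (g.compSubConstCLM ℂ (simpleId E j t)) (g.compSubConstCLM ℂ t)
    have h2 : C * (1 + ‖simpleId E j t‖) ^ k ≤ C * (2 * (1 + ‖t‖)) ^ k := by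
      gcongr
      linarith [norm_simpleId_le j t]
    rw [mul_pow] at h2
    have h3 := hb (simpleId E j t)
    have h4 := hb t
    calc _ ≤ ‖f t‖ * (C * (2 ^ k * (1 + ‖t‖) ^ k) + C * (1 + ‖t‖) ^ k) := by
          gcongr
          linarith
      _ = _ := by ring
  have hmeas : ∀ j, AEStronglyMeasurable (fun t => ‖f t‖ *
      p (g.compSubConstCLM ℂ (simpleId E j t) - g.compSubConstCLM ℂ t)) volume := by
    intro j
    have hm : Measurable fun t => p (g.compSubConstCLM ℂ (simpleId E j t) -
        g.compSubConstCLM ℂ t) := by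
      refine (simpleId E j).measurable_bind (fun a t => p (g.compSubConstCLM ℂ a -
        g.compSubConstCLM ℂ t)) fun a => ?_
      exact (hpc.comp (continuous_const.sub (continuous_compSubConstCLM g))).measurable
    exact (f.continuous.norm.measurable.mul hm).aestronglyMeasurable
  have hdom : Integrable fun t => (C * 2 ^ k + C) * (‖f t‖ * (1 + ‖t‖) ^ k) :=
    (integrable_norm_mul_one_add_norm_pow f k).const_mul _
  have hn : ∀ j t, ‖‖f t‖ * p (g.compSubConstCLM ℂ (simpleId E j t) - g.compSubConstCLM ℂ t)‖ ≤
      (C * 2 ^ k + C) * (‖f t‖ * (1 + ‖t‖) ^ k) := fun j t => by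
    rw [Real.norm_of_nonneg (mul_nonneg (norm_nonneg _) (apply_nonneg _ _))]
    exact hbound j t
  have hlim : Tendsto (fun j => ∫ t, ‖f t‖ *
      p (g.compSubConstCLM ℂ (simpleId E j t) - g.compSubConstCLM ℂ t)) atTop
      (𝓝 (∫ _ : E, (0 : ℝ))) := by
    refine tendsto_integral_of_dominated_convergence _ hmeas hdom
      (fun j => Eventually.of_forall (hn j)) (Eventually.of_forall fun t => ?_)
    have hc : Continuous fun a => ‖f t‖ * p (g.compSubConstCLM ℂ a - g.compSubConstCLM ℂ t) :=
      continuous_const.mul (hpc.comp ((continuous_compSubConstCLM g).sub continuous_const))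
    have := (hc.tendsto t).comp (tendsto_simpleId t)
    simpa [Function.comp_def] using this
  rw [integral_zero] at hlim
  exact squeeze_zero (fun j => apply_nonneg _ _) (fun j => seminorm_riemannSum_sub_conv_le f g _ k l
    (hdom.mono' (hmeas j) (Eventually.of_forall (hn j)))) hlim

/-- Continuity bounds `K` by finitely many Schwartz seminorms, each of which grows polynomially
along translates; the exponent is the largest weight among them. -/
theorem _root_.TemperedDistribution.exists_norm_apply_compSubConstCLM_le (K : 𝓢'(E, ℂ))
    (g : 𝓢(E, ℂ)) :
    ∃ (k : ℕ) (C : ℝ), 0 ≤ C ∧ ∀ a, ‖K (g.compSubConstCLM ℂ a)‖ ≤ C * (1 + ‖a‖) ^ k := by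
  have hKc : Continuous fun h : 𝓢(E, ℂ) => K h := K.continuous
  let L : 𝓢(E, ℂ) →ₗ[ℂ] ℂ :=
    { toFun := fun h => K h, map_add' := map_add K, map_smul' := map_smul K }
  obtain ⟨s, C, -, hC⟩ := Seminorm.bound_of_continuous (schwartz_withSeminorms ℂ E ℂ)
    ((normSeminorm ℂ ℂ).comp L) hKc.norm
  choose c hc0 hc using fun i : ℕ × ℕ => exists_seminorm_compSubConstCLM_le g i.1 i.2
  refine ⟨s.sup Prod.fst, C * ∑ i ∈ s, c i,
    mul_nonneg C.2 (Finset.sum_nonneg fun i _ => hc0 i), fun a => ?_⟩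
  have h1 : ‖K (g.compSubConstCLM ℂ a)‖ ≤
      C * (s.sup (schwartzSeminormFamily ℂ E ℂ)) (g.compSubConstCLM ℂ a) :=
    hC (g.compSubConstCLM ℂ a)
  have h2 : (s.sup (schwartzSeminormFamily ℂ E ℂ)) (g.compSubConstCLM ℂ a) ≤
      (∑ i ∈ s, schwartzSeminormFamily ℂ E ℂ i) (g.compSubConstCLM ℂ a) :=
    Seminorm.finset_sup_le_sum _ s _
  rw [sum_apply] at h2
  refine h1.trans ?_
  rw [mul_assoc, Finset.sum_mul]
  gcongr
  refine h2.trans (Finset.sum_le_sum fun i hi => (hc i a).trans ?_)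
  have := hc0 i
  gcongr
  · linarith [norm_nonneg a]
  · exact Finset.le_sup (f := Prod.fst) hi

/-- A tempered distribution can be interchanged with the integral in a convolution. -/
theorem _root_.TemperedDistribution.apply_conv (K : 𝓢'(E, ℂ)) (f g : 𝓢(E, ℂ)) :
    K (conv f g) = ∫ t, f t * K (g.compSubConstCLM ℂ t) := by
  have hKc : Continuous fun h : 𝓢(E, ℂ) => K h := K.continuous
  have h1 : Tendsto (fun j => K (riemannSum f g (simpleId E j))) atTop (𝓝 (K (conv f g))) :=
    (hKc.tendsto _).comp (tendsto_riemannSum f g)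
  have h2 : ∀ j, K (riemannSum f g (simpleId E j)) =
      ∫ t, f t * K (g.compSubConstCLM ℂ (simpleId E j t)) := fun j => by
    rw [riemannSum, map_sum,
      ← ((simpleId E j).sum_setIntegral_mul f.integrable fun t => K (g.compSubConstCLM ℂ t)).2]
    simp
  obtain ⟨k, C, hC, hb⟩ := K.exists_norm_apply_compSubConstCLM_le g
  have hc : Continuous fun a => K (g.compSubConstCLM ℂ a) :=
    hKc.comp (continuous_compSubConstCLM g)
  refine tendsto_nhds_unique h1 ?_
  simp_rw [h2]
  refine tendsto_integral_of_dominated_convergence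
    (fun t => C * 2 ^ k * (‖f t‖ * (1 + ‖t‖) ^ k))
    (fun j => (SimpleFunc.sum_setIntegral_mul f.integrable (simpleId E j)
      fun t => K (g.compSubConstCLM ℂ t)).1.aestronglyMeasurable)
    ((integrable_norm_mul_one_add_norm_pow f k).const_mul _)
    (fun j => Eventually.of_forall fun t => ?_) (Eventually.of_forall fun t => ?_)
  · rw [norm_mul]
    calc _ ≤ ‖f t‖ * (C * (2 * (1 + ‖t‖)) ^ k) := by
          gcongr
          refine (hb _).trans ?_
          gcongr
          linarith [norm_simpleId_le j t]
      _ = _ := by rw [mul_pow]; ring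
  · exact ((hc.tendsto t).comp (tendsto_simpleId t)).const_mul _

end SchwartzMap

/-! ### Density of compactly supported Schwartz functions -/

namespace SchwartzMap

variable {E : Type*} [NormedAddCommGroup E] [InnerProductSpace ℝ E] [FiniteDimensional ℝ E]

/-- Schwartz functions with compact support are dense. -/
theorem exists_hasCompactSupport_tendsto (f : 𝓢(E, ℂ)) :
    ∃ g : ℕ → 𝓢(E, ℂ), (∀ j, HasCompactSupport (g j)) ∧ Tendsto g atTop (𝓝 f) := by
  let χ : ContDiffBump (0 : E) := ⟨1, 2, one_pos, one_lt_two⟩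
  let c : ℕ → E → ℂ := fun j x => (χ (((j : ℝ) + 1)⁻¹ • x) : ℂ)
  have hχc : ContDiff ℝ ((⊤ : ℕ∞) : WithTop ℕ∞) fun x : E => (χ x : ℂ) :=
    Complex.ofRealCLM.contDiff.comp χ.contDiff
  have hc : ∀ j, ContDiff ℝ ((⊤ : ℕ∞) : WithTop ℕ∞) (c j) := fun j => hχc.comp (contDiff_const_smul _)
  have hcs : ∀ j, HasCompactSupport (c j) := fun j =>
    (χ.hasCompactSupport.comp_left Complex.ofReal_zero).comp_smul
      (by positivity : ((j : ℝ) + 1)⁻¹ ≠ 0)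
  have hct : ∀ j, (c j).HasTemperateGrowth := fun j => (hcs j).hasTemperateGrowth (hc j)
  refine ⟨fun j => smulLeftCLM ℂ (c j) f, fun j => ?_, ?_⟩
  · rw [smulLeftCLM_apply (hct j)]
    exact (hcs j).mul_right
  refine tendsto_nhds_iff_seminorm.2 fun k l => ?_
  -- Uniform in `j`, since the dilation factor `(j + 1)⁻¹` is at most `1`; the summand `1` accounts
  -- for the subtracted constant.
  have hbd : ∀ i : ℕ, ∃ C, 0 ≤ C ∧ ∀ j x, ‖iteratedFDeriv ℝ i (fun x => c j x - 1) x‖ ≤ C := by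
    intro i
    have hχs : HasCompactSupport fun x : E => (χ x : ℂ) :=
      χ.hasCompactSupport.comp_left Complex.ofReal_zero
    refine ⟨SchwartzMap.seminorm ℂ 0 i (hχs.toSchwartzMap hχc) + 1, by positivity, fun j x => ?_⟩
    have hj : ‖((j : ℝ) + 1)⁻¹‖ ≤ 1 := by
      rw [norm_inv, Real.norm_of_nonneg (by positivity)]
      exact inv_le_one_of_one_le₀ (by linarith [(Nat.cast_nonneg j : (0 : ℝ) ≤ j)])
    have h1 : ‖iteratedFDeriv ℝ i (c j) x‖ ≤
        SchwartzMap.seminorm ℂ 0 i (hχs.toSchwartzMap hχc) := by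
      rw [iteratedFDeriv_comp_const_smul _ (hχc.of_le (mod_cast le_top)), norm_smul, norm_pow]
      refine (mul_le_of_le_one_left (norm_nonneg _) (pow_le_one₀ (norm_nonneg _) hj)).trans ?_
      exact norm_iteratedFDeriv_le_seminorm ℂ (hχs.toSchwartzMap hχc) i _
    have h2 : ‖iteratedFDeriv ℝ i (fun _ : E => (1 : ℂ)) x‖ ≤ 1 := by
      rcases eq_or_ne i 0 with rfl | hi
      · simp
      · simp [iteratedFDeriv_const_of_ne hi]
    have h3 : iteratedFDeriv ℝ i (fun x => c j x - 1) x = iteratedFDeriv ℝ i (c j) x -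
        iteratedFDeriv ℝ i (fun _ : E => (1 : ℂ)) x :=
      iteratedFDeriv_sub_apply (((hc j).of_le (mod_cast le_top)).contDiffAt) contDiffAt_const
    rw [h3]
    exact (norm_sub_le _ _).trans (add_le_add h1 h2)
  have hloc : ∀ (i j : ℕ) (x : E), ‖x‖ < (j : ℝ) + 1 →
      iteratedFDeriv ℝ i (fun x => c j x - 1) x = 0 := by
    intro i j x hx
    have : (fun x => c j x - 1) =ᶠ[𝓝 x] 0 := by
      have hb : Metric.ball (0 : E) ((j : ℝ) + 1) ∈ 𝓝 x :=
        Metric.isOpen_ball.mem_nhds (by simpa using hx)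
      filter_upwards [hb] with y hy
      have h1 : χ (((j : ℝ) + 1)⁻¹ • y) = 1 := by
        apply χ.one_of_mem_closedBall
        have hj : (0 : ℝ) < (j : ℝ) + 1 := by positivity
        rw [mem_closedBall_zero_iff, norm_smul, norm_inv, Real.norm_of_nonneg hj.le,
          inv_mul_le_iff₀ hj]
        simpa [χ] using (mem_ball_zero_iff.1 hy).le
      simp [c, h1]
    rw [(this.iteratedFDeriv ℝ i).eq_of_nhds]
    simp
  choose C hC0 hC using hbd
  set B : ℝ := ∑ i ∈ Finset.range (l + 1), (l.choose i : ℝ) * C i *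
    SchwartzMap.seminorm ℂ (k + 1) (l - i) f with hB
  have hB0 : 0 ≤ B := Finset.sum_nonneg fun i _ => by have := hC0 i; positivity
  have key : ∀ j : ℕ, SchwartzMap.seminorm ℂ k l (smulLeftCLM ℂ (c j) f - f) ≤
      B / ((j : ℝ) + 1) := by
    intro j
    have hj : (0 : ℝ) < (j : ℝ) + 1 := by positivity
    refine seminorm_le_bound ℂ k l _ (by positivity) fun x => ?_
    have hfun : ⇑(smulLeftCLM ℂ (c j) f - f) = fun x => (c j x - 1) * f x := by
      funext y
      simp [hct j, sub_mul]
    have hle := norm_iteratedFDeriv_mul_le (𝕜 := ℝ) (f := fun x => c j x - 1) (g := f) (n := l)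
      (N := ((⊤ : ℕ∞) : WithTop ℕ∞)) ((hc j).sub contDiff_const) (f.smooth ⊤) x (mod_cast le_top)
    rw [hfun]
    rw [le_div_iff₀ hj]
    rcases lt_or_ge ‖x‖ ((j : ℝ) + 1) with hx | hx
    · have h0 : ‖iteratedFDeriv ℝ l (fun x => (c j x - 1) * f x) x‖ ≤ 0 := by
        refine hle.trans (le_of_eq (Finset.sum_eq_zero fun i _ => ?_))
        rw [hloc i j x hx]
        simp
      have h1 := le_antisymm h0 (norm_nonneg _)
      rw [h1]
      simpa using hB0
    -- Here `j + 1 ≤ ‖x‖`, so the factor `j + 1` is absorbed into one more power of the weight.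
    · calc ‖x‖ ^ k * ‖iteratedFDeriv ℝ l (fun x => (c j x - 1) * f x) x‖ * ((j : ℝ) + 1)
          ≤ ‖x‖ ^ k * (∑ i ∈ Finset.range (l + 1), (l.choose i : ℝ) *
              ‖iteratedFDeriv ℝ i (fun x => c j x - 1) x‖ *
              ‖iteratedFDeriv ℝ (l - i) f x‖) * ‖x‖ := by gcongr
        _ = ∑ i ∈ Finset.range (l + 1), (l.choose i : ℝ) *
              ‖iteratedFDeriv ℝ i (fun x => c j x - 1) x‖ *
              (‖x‖ ^ (k + 1) * ‖iteratedFDeriv ℝ (l - i) f x‖) := by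
            rw [Finset.mul_sum, Finset.sum_mul]
            refine Finset.sum_congr rfl fun i _ => ?_
            ring
        _ ≤ B := by
            refine Finset.sum_le_sum fun i _ => ?_
            have := hC0 i
            gcongr
            · exact hC i j x
            · exact le_seminorm ℂ (k + 1) (l - i) f x
  refine squeeze_zero (fun j => apply_nonneg _ _) key ?_
  exact tendsto_const_nhds.div_atTop
    (tendsto_atTop_add_const_right _ _ tendsto_natCast_atTop_atTop)

end SchwartzMap

/-! ### Banach function norms and weak doubling -/

namespace BanachFunctionNorm

variable {n : ℕ} (X : BanachFunctionNorm n)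

theorem toFun_congr {f g : Rn n → ℝ≥0∞} (hf : AEMeasurable f volume) (hg : AEMeasurable g volume)
    (h : f =ᵐ[volume] g) : X.toFun f = X.toFun g :=
  le_antisymm (X.mono g f hg hf h.le) (X.mono f g hf hg h.symm.le)

theorem norm_congr {f g : Rn n → ℂ} (hf : AEStronglyMeasurable f volume)
    (hg : AEStronglyMeasurable g volume) (h : f =ᵐ[volume] g) : X.norm f = X.norm g :=
  X.toFun_congr hf.enorm hg.enorm (h.mono fun x hx => by simp only [hx])

theorem norm_mono {f g : Rn n → ℂ} (hf : AEStronglyMeasurable f volume)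
    (hg : AEStronglyMeasurable g volume) (h : ∀ x, ‖f x‖ₑ ≤ ‖g x‖ₑ) : X.norm f ≤ X.norm g :=
  X.mono _ _ hg.enorm hf.enorm (Eventually.of_forall h)

theorem norm_const_mul (c : ℂ) {f : Rn n → ℂ} (hf : AEStronglyMeasurable f volume) :
    X.norm (fun x => c * f x) = ‖c‖ₑ * X.norm f := by
  rw [norm, norm, enorm_eq_nnnorm, ← X.smul _ _ hf.enorm]
  simp [enorm_eq_nnnorm]

theorem norm_eq_zero_iff {f : Rn n → ℂ} (hf : AEStronglyMeasurable f volume) :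
    X.norm f = 0 ↔ f =ᵐ[volume] 0 := by
  rw [norm, X.eq_zero_iff _ hf.enorm]
  constructor <;> intro h <;> filter_upwards [h] with x hx <;> simpa using hx

theorem norm_sum_le {ι : Type*} (s : Finset ι) {f : ι → Rn n → ℂ}
    (hf : ∀ i ∈ s, AEStronglyMeasurable (f i) volume) :
    X.norm (fun x => ∑ i ∈ s, f i x) ≤ ∑ i ∈ s, X.norm (f i) := by
  classical
  induction s using Finset.induction_on with
  | empty =>
    simp only [Finset.sum_empty]
    exact ((X.norm_eq_zero_iff aestronglyMeasurable_const).2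
      (Eventually.of_forall fun _ => rfl)).le
  | insert a s ha ih =>
    have h1 : AEStronglyMeasurable (f a) volume := hf a (Finset.mem_insert_self a s)
    have h2 : AEStronglyMeasurable (fun x => ∑ i ∈ s, f i x) volume :=
      Finset.aestronglyMeasurable_fun_sum s fun i hi => hf i (Finset.mem_insert_of_mem hi)
    simp only [Finset.sum_insert ha]
    calc X.norm (fun x => f a x + ∑ i ∈ s, f i x)
        ≤ X.toFun (fun x => ‖f a x‖ₑ + ‖∑ i ∈ s, f i x‖ₑ) :=
          X.mono _ _ (h1.enorm.add h2.enorm) (h1.add h2).enorm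
            (Eventually.of_forall fun x => enorm_add_le _ _)
      _ ≤ X.norm (f a) + X.norm (fun x => ∑ i ∈ s, f i x) := X.add_le _ _ h1.enorm h2.enorm
      _ ≤ _ := by
          gcongr
          exact ih fun i hi => hf i (Finset.mem_insert_of_mem hi)

/-- Fatou's lemma in a Banach function space. -/
theorem norm_le_of_tendsto {f : ℕ → Rn n → ℂ} {g : Rn n → ℂ} {C : ℝ≥0∞}
    (hf : ∀ j, Measurable (f j)) (hfg : ∀ x, Tendsto (fun j => f j x) atTop (𝓝 (g x)))
    (hC : ∀ j, X.norm (f j) ≤ C) : X.norm g ≤ C := by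
  have hg : Measurable g := measurable_of_tendsto_metrizable hf (tendsto_pi_nhds.2 hfg)
  -- The tail infima increase to `‖g x‖ₑ`, so the Fatou property applies to them, and the `j`-th one
  -- is dominated by `‖f j x‖ₑ`.
  have hm : ∀ j, Measurable fun x => ⨅ i ≥ j, ‖f i x‖ₑ := fun j =>
    Measurable.iInf fun i => Measurable.iInf fun _ => (hf i).enorm
  refine le_of_tendsto' (X.fatou (fun j x => ⨅ i ≥ j, ‖f i x‖ₑ) (fun x => ‖g x‖ₑ)
    (fun j => (hm j).aemeasurable) hg.enorm.aemeasurable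
    (Eventually.of_forall fun x => ?_)).2 fun j => ?_
  · have hmono : Monotone fun j => ⨅ i ≥ j, ‖f i x‖ₑ := fun j k hjk =>
      le_iInf₂ fun i hi => iInf₂_le i (hjk.trans hi)
    refine ⟨hmono, ?_⟩
    have h1 := tendsto_atTop_iSup hmono
    have h2 : Tendsto (fun j => ‖f j x‖ₑ) atTop (𝓝 ‖g x‖ₑ) :=
      (continuous_enorm.tendsto (g x)).comp (hfg x)
    rwa [← liminf_eq_iSup_iInf_of_nat, h2.liminf_eq] at h1
  · exact (X.mono _ _ (hf j).enorm.aemeasurable (hm j).aemeasurable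
      (Eventually.of_forall fun x => iInf₂_le j le_rfl)).trans (hC j)

theorem ballNorm_eq (y : Rn n) (R : ℝ) :
    X.ballNorm y R = X.toFun ((Metric.ball y R).indicator 1) := by
  rw [ballNorm, norm]
  congr 1
  funext x
  by_cases hx : x ∈ Metric.ball y R <;> simp [hx]

theorem ballNorm_lt_top (y : Rn n) (R : ℝ) : X.ballNorm y R < ∞ := by
  rw [ballNorm_eq]
  exact X.indicator_lt_top _ measurableSet_ball.nullMeasurableSet measure_ball_lt_top

theorem ballNorm_ne_zero (y : Rn n) {R : ℝ} (hR : 0 < R) : X.ballNorm y R ≠ 0 := by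
  rw [ballNorm_eq, ne_eq, X.eq_zero_iff _ (measurable_one.indicator measurableSet_ball).aemeasurable]
  intro h
  have h0 : volume (Metric.ball y R) = 0 := by
    refine measure_mono_null (fun x hx => ?_) (ae_iff.1 h)
    simpa using hx
  exact (Metric.measure_ball_pos volume y hR).ne' h0

variable {X}

/-- Weak doubling self-improves: for a small dilation the ratio of the norms of concentric balls
comes arbitrarily close to `1`, for arbitrarily large balls. -/
theorem WeakDoubling.exists_ballNorm_le (hX : X.WeakDoubling) {θ : ℝ≥0} (hθ : 1 < θ) :
    ∃ σ : ℝ, 1 < σ ∧ ∀ R₀ : ℝ, ∃ R y, R₀ ≤ R ∧ 0 < R ∧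
      X.ballNorm y (σ * R) ≤ θ * X.ballNorm y R := by
  obtain ⟨τ, hτ, hlim⟩ := hX
  obtain ⟨C, hlC, hC⟩ := ENNReal.lt_iff_exists_nnreal_btwn.1 hlim
  -- With `θ ^ (m + 1) > C` and `σ = τ ^ (1 / (m + 1))`, a ratio above `θ` at each of the radii `R,
  -- σR, …, σ ^ m R` would multiply up to a ratio above `C` between the radii `τR` and `R`.
  obtain ⟨m, hm⟩ := pow_unbounded_of_one_lt C hθ
  have hm1 : C < θ ^ (m + 1) := hm.trans (pow_lt_pow_right₀ hθ (Nat.lt_succ_self m))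
  have hτ0 : 0 < τ := one_pos.trans hτ
  set σ : ℝ := τ ^ ((m + 1 : ℕ) : ℝ)⁻¹ with hσ
  have hσ1 : 1 < σ := Real.one_lt_rpow hτ (by positivity)
  have hσm : σ ^ (m + 1) = τ := Real.rpow_inv_natCast_pow hτ0.le (Nat.succ_ne_zero m)
  refine ⟨σ, hσ1, fun R₀ => ?_⟩
  obtain ⟨R, hR, hRC⟩ :=
    (frequently_atTop.1 (frequently_lt_of_liminf_lt (by isBoundedDefault) hlC)) (max R₀ 1)
  obtain ⟨y, hy⟩ := iInf_lt_iff.1 hRC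
  have hR0 : 0 < R := one_pos.trans_le ((le_max_right _ _).trans hR)
  by_contra! hcon
  have hpow : ∀ i : ℕ, R ≤ σ ^ i * R := fun i =>
    le_mul_of_one_le_left hR0.le (one_le_pow₀ hσ1.le)
  have hi : ∀ i : ℕ, (θ : ℝ≥0∞) ^ i * X.ballNorm y R ≤ X.ballNorm y (σ ^ i * R) := by
    intro i
    induction i with
    | zero => simp
    | succ i ih =>
      have := hcon (σ ^ i * R) y ((le_max_left _ _).trans (hR.trans (hpow i)))
        (hR0.trans_le (hpow i))
      calc (θ : ℝ≥0∞) ^ (i + 1) * X.ballNorm y R = θ * (θ ^ i * X.ballNorm y R) := by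
            rw [pow_succ]; ring
        _ ≤ θ * X.ballNorm y (σ ^ i * R) := by gcongr
        _ ≤ X.ballNorm y (σ * (σ ^ i * R)) := this.le
        _ = _ := by rw [pow_succ, ← mul_assoc, mul_comm σ]
  have h1 := hi (m + 1)
  rw [hσm] at h1
  have h2 : X.ballNorm y (τ * R) < C * X.ballNorm y R :=
    (ENNReal.div_lt_iff (Or.inl (X.ballNorm_ne_zero y hR0))
      (Or.inl (X.ballNorm_lt_top y R).ne)).1 hy
  have h3 : (C : ℝ≥0∞) * X.ballNorm y R ≤ (θ : ℝ≥0∞) ^ (m + 1) * X.ballNorm y R := by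
    gcongr
    exact_mod_cast hm1.le
  exact absurd (h1.trans_lt (h2.trans_le h3)) (lt_irrefl _)

end BanachFunctionNorm

/-! ### Modulations and the function representing a multiplier operator -/

namespace SchwartzMap

variable {E : Type*} [NormedAddCommGroup E] [InnerProductSpace ℝ E] [FiniteDimensional ℝ E]
  [MeasurableSpace E] [BorelSpace E]

/-- The pointwise product of scalar Schwartz functions. -/
noncomputable abbrev prod (f g : 𝓢(E, ℂ)) : 𝓢(E, ℂ) := pairing (ContinuousLinearMap.mul ℂ ℂ) f g

theorem fourierInv_apply_eq_fourier_neg (f : 𝓢(E, ℂ)) (x : E) : 𝓕⁻ f x = 𝓕 f (-x) := by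
  rw [fourierInv_apply_eq]
  simp

theorem fourier_conv (f g : 𝓢(E, ℂ)) : 𝓕 (conv f g) = prod (𝓕 f) (𝓕 g) :=
  fourier_convolution _ f g

theorem conv_fourier (f g : 𝓢(E, ℂ)) : conv (𝓕 f) (𝓕 g) = 𝓕 (prod f g) := by
  have h : 𝓕⁻ (conv (𝓕 f) (𝓕 g)) = prod f g := by
    ext x
    rw [fourierInv_apply_eq_fourier_neg, fourier_conv]
    simp only [pairing_apply_apply, ← fourierInv_apply_eq_fourier_neg,
      FourierTransform.fourierInv_fourier_eq]
  rw [← h, FourierTransform.fourier_fourierInv_eq]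

theorem fourier_compSubConstCLM_neg_apply (u : 𝓢(E, ℂ)) (x ξ : E) :
    𝓕 (u.compSubConstCLM ℂ (-x)) ξ = 𝐞 (inner ℝ x ξ) • 𝓕 u ξ := by
  rw [fourier_coe, fourier_coe, Real.fourier_eq, Real.fourier_eq, Circle.smul_def,
    ← integral_smul, ← integral_sub_right_eq_self _ x]
  refine integral_congr_ae (Eventually.of_forall fun t => ?_)
  simp only [compSubConstCLM_apply, sub_neg_eq_add, sub_add_cancel, inner_sub_left,
    ← Circle.smul_def, smul_smul, ← AddChar.map_add_eq_mul]
  congr 2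
  ring

theorem fourierInv_compSubConstCLM_apply (f : 𝓢(E, ℂ)) (η x : E) :
    𝓕⁻ (f.compSubConstCLM ℂ η) x = 𝐞 (inner ℝ η x) • 𝓕⁻ f x := by
  rw [fourierInv_apply_eq_fourier_neg, fourierInv_apply_eq_fourier_neg]
  have := fourier_compSubConstCLM_neg_apply f (-η) (-x)
  rwa [neg_neg, inner_neg_neg] at this

/-- The modulation `x ↦ e^{2πi⟨η, x⟩} u(x)` of a Schwartz function, as a translation on the Fourier
side. -/
noncomputable def modulation (η : E) (u : 𝓢(E, ℂ)) : 𝓢(E, ℂ) := 𝓕⁻ ((𝓕 u).compSubConstCLM ℂ η)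

theorem enorm_modulation_apply (η : E) (u : 𝓢(E, ℂ)) (x : E) :
    ‖modulation η u x‖ₑ = ‖u x‖ₑ := by
  rw [modulation, fourierInv_compSubConstCLM_apply, FourierTransform.fourierInv_fourier_eq,
    ← ofReal_norm, Circle.norm_smul, ofReal_norm]

/-- Translation and modulation commute up to a unimodular scalar. Hence a frequency shift inside `b`
has the modulus of `multFun b` at a modulated function. -/
theorem fourier_compSubConstCLM_modulation (η x : E) (u : 𝓢(E, ℂ)) :
    𝓕 ((modulation η u).compSubConstCLM ℂ (-x)) =
      ((𝐞 (inner ℝ x η) : Circle) : ℂ) •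
        (𝓕 (u.compSubConstCLM ℂ (-x))).compSubConstCLM ℂ η := by
  ext ξ
  rw [fourier_compSubConstCLM_neg_apply, modulation, FourierTransform.fourier_fourierInv_eq]
  change _ = (_ : ℂ) • (𝓕 (u.compSubConstCLM ℂ (-x))) (ξ - η)
  rw [fourier_compSubConstCLM_neg_apply, ← Circle.smul_def, smul_smul, ← AddChar.map_add_eq_mul,
    ← inner_add_right, add_sub_cancel]
  rfl

end SchwartzMap

namespace TemperedDistribution

open SchwartzMap

variable {E : Type*} [NormedAddCommGroup E] [InnerProductSpace ℝ E] [FiniteDimensional ℝ E]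
  [MeasurableSpace E] [BorelSpace E]

/-- The function `x ↦ ⟨b, e^{2πi⟨x, ·⟩} 𝓕u⟩` that represents `𝓕⁻ (b 𝓕u)`. -/
noncomputable def multFun (b : 𝓢'(E, ℂ)) (u : 𝓢(E, ℂ)) (x : E) : ℂ :=
  b (𝓕 (u.compSubConstCLM ℂ (-x)))

theorem continuous_apply_fourier_compSubConstCLM (b : 𝓢'(E, ℂ)) (u : 𝓢(E, ℂ)) (η : E) :
    Continuous fun x => b ((𝓕 (u.compSubConstCLM ℂ (-x))).compSubConstCLM ℂ η) := by
  have hb : Continuous fun h : 𝓢(E, ℂ) => b h := b.continuous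
  have hF : Continuous fun h : 𝓢(E, ℂ) => 𝓕 h :=
    (FourierTransform.fourierCLM ℂ 𝓢(E, ℂ)).continuous
  exact hb.comp ((compSubConstCLM ℂ η (E := E) (F := ℂ)).continuous.comp
    (hF.comp ((continuous_compSubConstCLM u).comp continuous_neg)))

theorem continuous_multFun (b : 𝓢'(E, ℂ)) (u : 𝓢(E, ℂ)) : Continuous (multFun b u) := by
  simpa using! continuous_apply_fourier_compSubConstCLM b u 0

/-- The product equals `𝓕` of the convolution of `u` with the reflection of `w`, and `𝓕 b` may be
moved inside that convolution by `apply_conv`. -/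
theorem apply_prod_fourier_fourierInv (b : 𝓢'(E, ℂ)) (u w : 𝓢(E, ℂ)) :
    b (prod (𝓕 u) (𝓕⁻ w)) = ∫ x, multFun b u x * w x := by
  set w' : 𝓢(E, ℂ) := 𝓕⁻ (𝓕⁻ w) with hw'
  have h1 : prod (𝓕 u) (𝓕⁻ w) = 𝓕 (conv w' u) := by
    rw [fourier_conv, hw', FourierTransform.fourier_fourierInv_eq]
    ext x
    simp [mul_comm]
  have h2 : ∀ x, w' x = w (-x) := fun x => by
    rw [hw', fourierInv_apply_eq_fourier_neg, FourierTransform.fourier_fourierInv_eq]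
  have h3 := apply_conv (𝓕 b) w' u
  rw [fourier_apply] at h3
  rw [h1, h3, ← integral_neg_eq_self]
  refine integral_congr_ae (Eventually.of_forall fun x => ?_)
  simp only [h2, neg_neg, fourier_apply, multFun]
  ring

theorem enorm_multFun_modulation (b : 𝓢'(E, ℂ)) (η x : E) (u : 𝓢(E, ℂ)) :
    ‖multFun b (modulation η u) x‖ₑ =
      ‖b ((𝓕 (u.compSubConstCLM ℂ (-x))).compSubConstCLM ℂ η)‖ₑ := by
  rw [multFun, fourier_compSubConstCLM_modulation, map_smul, ← Circle.smul_def, ← ofReal_norm,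
    Circle.norm_smul, ofReal_norm]

end TemperedDistribution

/-! ### The `L¹` bound for the symbol -/

theorem MeasureTheory.SimpleFunc.sum_enorm_setIntegral_le {α β : Type*} [MeasurableSpace α]
    {μ : Measure α} (v : α → ℂ) (s : SimpleFunc α β) :
    ∑ k ∈ s.range, ‖∫ t in s ⁻¹' {k}, v t ∂μ‖ₑ ≤ ∫⁻ t, ‖v t‖ₑ ∂μ := by
  classical
  calc ∑ k ∈ s.range, ‖∫ t in s ⁻¹' {k}, v t ∂μ‖ₑ
      ≤ ∑ k ∈ s.range, ∫⁻ t in s ⁻¹' {k}, ‖v t‖ₑ ∂μ :=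
        Finset.sum_le_sum fun k _ => enorm_integral_le_lintegral_enorm _
    _ = ∫⁻ t in ⋃ k ∈ s.range, s ⁻¹' {k}, ‖v t‖ₑ ∂μ := by
        rw [lintegral_biUnion_finset]
        · intro i _ j _ hij
          exact Disjoint.preimage _ (by simpa using hij)
        · exact fun k _ => s.measurableSet_fiber k
    _ ≤ _ := setLIntegral_le_lintegral _ _

namespace BanachFunctionNorm

open SchwartzMap TemperedDistribution

variable {n : ℕ} (X : BanachFunctionNorm n)

/-- The norm of a distribution given by a continuous function is at least the norm of the
function. -/
theorem norm_le_distNorm {T : 𝓢'(Rn n, ℂ)} {g : Rn n → ℂ} (hg : Continuous g)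
    (hT : ∀ w : 𝓢(Rn n, ℂ), T w = ∫ x, g x * w x) : X.norm g ≤ X.distNorm T := by
  refine le_iInf₂ fun f hf => le_of_eq ?_
  refine X.norm_congr hg.aestronglyMeasurable hf.1.aestronglyMeasurable ?_
  -- Any locally integrable representative agrees a.e. with `g`, because both have the same
  -- integrals against test functions.
  refine ae_eq_of_integral_contDiff_smul_eq hg.locallyIntegrable hf.1 fun φ hφ hφs => ?_
  have hsupp : HasCompactSupport fun x => (φ x : ℂ) := hφs.comp_left Complex.ofReal_zero
  have hsm : ContDiff ℝ ((⊤ : ℕ∞) : WithTop ℕ∞) fun x => (φ x : ℂ) :=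
    Complex.ofRealCLM.contDiff.comp hφ
  have h1 := hf.2 (hsupp.toSchwartzMap hsm) hsupp
  rw [hT] at h1
  simpa [mul_comm] using h1

theorem norm_modulation (η : Rn n) (u : 𝓢(Rn n, ℂ)) : X.norm (modulation η u) = X.norm u := by
  simp only [norm, enorm_modulation_apply]

variable {X}

/-- Minkowski's inequality for an average of modulated multiplier operators. -/
theorem norm_apply_conv_le {b : 𝓢'(Rn n, ℂ)} {M : ℝ≥0∞} {u : 𝓢(Rn n, ℂ)}
    (hM : ∀ η, X.norm (multFun b (modulation η u)) ≤ M * X.norm u) (v : 𝓢(Rn n, ℂ)) :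
    X.norm (fun x => b (conv v (𝓕 (u.compSubConstCLM ℂ (-x))))) ≤
      (∫⁻ t, ‖v t‖ₑ) * (M * X.norm u) := by
  have hb : Continuous fun h : 𝓢(Rn n, ℂ) => b h := b.continuous
  have hcont := continuous_apply_fourier_compSubConstCLM b u
  have hsum : ∀ (s : SimpleFunc (Rn n) (Rn n)) x,
      b (riemannSum v (𝓕 (u.compSubConstCLM ℂ (-x))) s) = ∑ k ∈ s.range,
        (∫ t in s ⁻¹' {k}, v t) * b ((𝓕 (u.compSubConstCLM ℂ (-x))).compSubConstCLM ℂ k) := by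
    intro s x
    simp [riemannSum, map_sum]
  -- Riemann sums replace a vector-valued integral: the triangle inequality bounds each finite sum,
  -- and Fatou's lemma passes to the pointwise limit.
  refine X.norm_le_of_tendsto
    (f := fun j x => b (riemannSum v (𝓕 (u.compSubConstCLM ℂ (-x))) (simpleId (Rn n) j)))
    (fun j => ?_) (fun x => (hb.tendsto _).comp (tendsto_riemannSum v _)) fun j => ?_
  · simp only [hsum]
    exact Finset.measurable_fun_sum _ fun k _ => (hcont k).measurable.const_mul _
  · simp only [hsum]
    calc _ ≤ ∑ k ∈ (simpleId (Rn n) j).range, ‖∫ t in simpleId (Rn n) j ⁻¹' {k}, v t‖ₑ *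
          (M * X.norm u) := by
          refine (X.norm_sum_le _ fun k _ =>
            ((hcont k).const_mul _).aestronglyMeasurable).trans (Finset.sum_le_sum fun k _ => ?_)
          rw [X.norm_const_mul _ (hcont k).aestronglyMeasurable]
          gcongr
          refine le_trans (le_of_eq ?_) (hM k)
          simp only [norm, enorm_multFun_modulation]
      _ ≤ _ := by
          rw [← Finset.sum_mul]
          gcongr
          exact SimpleFunc.sum_enorm_setIntegral_le _ _

/-- The `L¹` bound for a symbol, tested against functions with compactly supported Fourier
transform. -/
theorem WeakDoubling.enorm_apply_fourier_le (hX : X.WeakDoubling) {b : 𝓢'(Rn n, ℂ)} {M : ℝ≥0}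
    (hM : ∀ u : 𝓢(Rn n, ℂ), u ≠ 0 → X.norm u < ∞ → X.norm (multFun b u) ≤ M * X.norm u)
    {w : 𝓢(Rn n, ℂ)} (hw : HasCompactSupport w) :
    ‖b (𝓕 w)‖ₑ ≤ M * ∫⁻ t, ‖𝓕 w t‖ₑ := by
  obtain ⟨r, hr0, hr⟩ : ∃ r, 0 < r ∧ ∀ x, r ≤ ‖x‖ → w x = 0 := by
    obtain ⟨r, hr0, hr⟩ := hw.isCompact.isBounded.subset_ball_lt 0 0
    refine ⟨r, hr0, fun x hx => image_eq_zero_of_notMem_tsupport fun hmem => ?_⟩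
    exact absurd (mem_ball_zero_iff.1 (hr hmem)) (not_lt.2 hx)
  have key : ∀ θ : ℝ≥0, 1 < θ → ‖b (𝓕 w)‖ₑ ≤ θ * (M * ∫⁻ t, ‖𝓕 w t‖ₑ) := by
    intro θ hθ
    obtain ⟨σ, hσ, hball⟩ := hX.exists_ballNorm_le hθ
    -- This lower bound on `R` gives `(σ - 1) R ≥ 2r > r`, leaving room for a cutoff between the
    -- radii `R + r` and `σR`.
    obtain ⟨R, y, hR, hR0, hle⟩ := hball (2 * r / (σ - 1))
    have hRr : R + r < σ * R := by
      rw [div_le_iff₀ (by linarith)] at hR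
      linarith
    let χ : ContDiffBump y := ⟨R + r, σ * R, by linarith, hRr⟩
    have hχs : HasCompactSupport fun x => (χ x : ℂ) :=
      χ.hasCompactSupport.comp_left Complex.ofReal_zero
    let u : 𝓢(Rn n, ℂ) := hχs.toSchwartzMap (Complex.ofRealCLM.contDiff.comp χ.contDiff)
    have hu : ∀ x, u x = (χ x : ℂ) := fun _ => rfl
    have huball : X.norm u ≤ X.ballNorm y (σ * R) := by
      refine X.norm_mono u.continuous.aestronglyMeasurable
        (stronglyMeasurable_one.indicator measurableSet_ball).aestronglyMeasurable fun x => ?_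
      by_cases hx : x ∈ Metric.ball y (σ * R)
      · rw [Set.indicator_of_mem hx, hu, ← ofReal_norm, ← ofReal_norm]
        refine ENNReal.ofReal_le_ofReal ?_
        simpa [abs_of_nonneg χ.nonneg] using χ.le_one (x := x)
      · have : χ x = 0 := χ.zero_of_le_dist (by simpa using hx)
        simp [hu, this]
    have hutop : X.norm u < ∞ := huball.trans_lt (X.ballNorm_lt_top _ _)
    have hu0 : u ≠ 0 := by
      intro h0
      have h1 : u y = 1 := by
        rw [hu, χ.one_of_mem_closedBall (Metric.mem_closedBall_self χ.rIn_pos.le)]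
        simp
      rw [h0] at h1
      simp at h1
    have hMη : ∀ η, X.norm (multFun b (modulation η u)) ≤ M * X.norm u := by
      intro η
      rw [← X.norm_modulation η u]
      refine hM _ (fun h0 => hu0 ?_) (by rwa [X.norm_modulation])
      ext x
      have := enorm_modulation_apply η u x
      rw [h0] at this
      simpa using this.symm
    -- On the support of `w` the point `z + x` lies in `B(y, R + r)`, where the cutoff equals `1`.
    have hconv : ∀ x ∈ Metric.ball y R,
        conv (𝓕 w) (𝓕 (u.compSubConstCLM ℂ (-x))) = 𝓕 w := by
      intro x hx
      rw [conv_fourier]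
      congr 1
      ext z
      rw [pairing_apply_apply, compSubConstCLM_apply, ContinuousLinearMap.mul_apply']
      rcases lt_or_ge ‖z‖ r with hz | hz
      · rw [hu, χ.one_of_mem_closedBall, Complex.ofReal_one, mul_one]
        rw [Metric.mem_closedBall, sub_neg_eq_add, dist_eq_norm, add_sub_assoc]
        have h1 : ‖x - y‖ < R := by rwa [← dist_eq_norm]
        have h2 := norm_add_le z (x - y)
        change _ ≤ R + r
        linarith
      · rw [hr z hz, zero_mul]
    have hlow : ‖b (𝓕 w)‖ₑ * X.ballNorm y R ≤
        X.norm (fun x => b (conv (𝓕 w) (𝓕 (u.compSubConstCLM ℂ (-x))))) := by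
      have hind : AEStronglyMeasurable ((Metric.ball y R).indicator (1 : Rn n → ℂ)) volume :=
        (stronglyMeasurable_one.indicator measurableSet_ball).aestronglyMeasurable
      rw [ballNorm, ← X.norm_const_mul _ hind]
      refine X.norm_mono (hind.const_mul _) ?_ fun x => ?_
      · have hb : Continuous fun h : 𝓢(Rn n, ℂ) => b h := b.continuous
        have hc : Continuous fun h : 𝓢(Rn n, ℂ) => conv (𝓕 w) h :=
          (SchwartzMap.convolution (ContinuousLinearMap.mul ℂ ℂ) (𝓕 w)).continuous
        have hF : Continuous fun h : 𝓢(Rn n, ℂ) => 𝓕 h :=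
          (FourierTransform.fourierCLM ℂ 𝓢(Rn n, ℂ)).continuous
        exact (hb.comp (hc.comp (hF.comp
          ((continuous_compSubConstCLM u).comp continuous_neg)))).aestronglyMeasurable
      · by_cases hx : x ∈ Metric.ball y R
        · rw [hconv x hx]
          simp [hx]
        · simp [Set.indicator_of_notMem hx]
    have hfin := hlow.trans (norm_apply_conv_le hMη (𝓕 w))
    have hB0 := X.ballNorm_ne_zero y hR0
    have hBt := (X.ballNorm_lt_top y R).ne
    refine (ENNReal.mul_le_mul_iff_left hB0 hBt).1 (hfin.trans ?_)
    calc (∫⁻ t, ‖𝓕 w t‖ₑ) * (M * X.norm u)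
        ≤ (∫⁻ t, ‖𝓕 w t‖ₑ) * (M * (θ * X.ballNorm y R)) := by
          gcongr
          exact huball.trans hle
      _ = _ := by ring
  have hlim : Tendsto (fun θ : ℝ≥0 => (θ : ℝ≥0∞) * (M * ∫⁻ t, ‖𝓕 w t‖ₑ)) (𝓝[>] 1)
      (𝓝 (1 * (M * ∫⁻ t, ‖𝓕 w t‖ₑ))) :=
    ENNReal.Tendsto.mul_const
      ((ENNReal.tendsto_coe.2 tendsto_id).mono_left nhdsWithin_le_nhds) (Or.inl one_ne_zero)
  rw [one_mul] at hlim
  exact ge_of_tendsto hlim (eventually_nhdsWithin_of_forall key)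

/-- The `L¹` bound for a symbol. -/
theorem WeakDoubling.norm_apply_le (hX : X.WeakDoubling) {b : 𝓢'(Rn n, ℂ)} {M : ℝ≥0}
    (hM : ∀ u : 𝓢(Rn n, ℂ), u ≠ 0 → X.norm u < ∞ → X.norm (multFun b u) ≤ M * X.norm u)
    (v : 𝓢(Rn n, ℂ)) : ‖b v‖ ≤ M * ∫ t, ‖v t‖ := by
  have hb : Continuous fun h : 𝓢(Rn n, ℂ) => b h := b.continuous
  have hF : Continuous fun h : 𝓢(Rn n, ℂ) => 𝓕 h :=
    (FourierTransform.fourierCLM ℂ 𝓢(Rn n, ℂ)).continuous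
  obtain ⟨w, hw, hlim⟩ := exists_hasCompactSupport_tendsto (𝓕⁻ v)
  have hlim' : Tendsto (fun j => 𝓕 (w j)) atTop (𝓝 v) := by
    have := (hF.tendsto _).comp hlim
    rwa [FourierTransform.fourier_fourierInv_eq] at this
  have hL1 : Continuous fun h : 𝓢(Rn n, ℂ) => ∫ t, ‖h t‖ := by
    simp_rw [← norm_toLp_one]
    exact (toLpCLM ℂ ℂ 1 (volume : Measure (Rn n))).continuous.norm
  refine le_of_tendsto_of_tendsto' ((hb.tendsto _).comp hlim').norm
    (((hL1.tendsto _).comp hlim').const_mul (M : ℝ)) fun j => ?_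
  have h1 := hX.enorm_apply_fourier_le hM (hw j)
  rw [← ofReal_integral_norm_eq_lintegral_enorm (𝓕 (w j)).integrable, ← ofReal_norm,
    ← ENNReal.ofReal_coe_nnreal, ← ENNReal.ofReal_mul M.coe_nonneg] at h1
  exact (ENNReal.ofReal_le_ofReal_iff (mul_nonneg M.coe_nonneg (integral_nonneg fun _ => norm_nonneg _))).1 h1

end BanachFunctionNorm

/-! ### From the `L¹` bound to a bounded function -/

/-- A function whose products with all square integrable functions are controlled by the weight `p`
is controlled by `p` almost everywhere. -/
theorem MeasureTheory.ae_norm_le_of_norm_integral_mul_le {α : Type*} [MeasurableSpace α] {μ : Measure α}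
    {F : α → ℂ} (hF : MemLp F 2 μ) {p : α → ℝ} (hp : MemLp p 2 μ) (hp0 : ∀ x, 0 < p x) {M : ℝ}
    (hM : 0 ≤ M) (h : ∀ G : α → ℂ, MemLp G 2 μ → ‖∫ x, F x * G x ∂μ‖ ≤ M * ∫ x, p x * ‖G x‖ ∂μ) :
    ∀ᵐ x ∂μ, ‖F x‖ ≤ M * p x := by
  let sg : ℂ → ℂ := fun z => (starRingEnd ℂ) z / (‖z‖ : ℂ)
  have hsgm : Measurable sg := by
    have h1 : Measurable fun z : ℂ => (starRingEnd ℂ) z := Complex.continuous_conj.measurable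
    have h2 : Measurable fun z : ℂ => (‖z‖ : ℂ) :=
      (Complex.continuous_ofReal.comp continuous_norm).measurable
    exact h1.div h2
  have hsg1 : ∀ z, ‖sg z‖ ≤ 1 := fun z => by
    simp only [sg, norm_div, RCLike.norm_conj, Complex.norm_real, norm_norm]
    exact div_self_le_one _
  have hsg : ∀ z, z * sg z = (‖z‖ : ℂ) := fun z => by
    rcases eq_or_ne z 0 with rfl | hz
    · simp
    · have : (‖z‖ : ℂ) ≠ 0 := by simpa using hz
      simp only [sg]
      rw [← mul_div_assoc, Complex.mul_conj, Complex.normSq_eq_norm_sq, div_eq_iff this]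
      push_cast
      ring
  have hpF : Integrable (fun x => p x * ‖F x‖) μ := hp.integrable_mul hF.norm
  have hpp : Integrable (fun x => M * (p x * p x)) μ := (hp.integrable_mul hp).const_mul M
  have hle : (fun x => p x * ‖F x‖) ≤ᵐ[μ] fun x => M * (p x * p x) := by
    refine ae_le_of_forall_setIntegral_le hpF hpp fun s hs _ => ?_
    -- Testing with `p` times the conjugate phase of `F` turns the hypothesis into `∫_s p |F| ≤ M
    -- ∫_s p²` for each `s`; dividing by `p > 0` then gives the pointwise bound.
    set G : α → ℂ := s.indicator fun x => (p x : ℂ) * sg (F x) with hG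
    have hG0 : MemLp (fun x => (p x : ℂ) * sg (F x)) 2 μ := by
      refine hp.mono ((Complex.continuous_ofReal.comp_aestronglyMeasurable
        hp.aestronglyMeasurable).mul
        (hsgm.comp_aemeasurable hF.aestronglyMeasurable.aemeasurable).aestronglyMeasurable)
        (Eventually.of_forall fun x => ?_)
      rw [norm_mul, Complex.norm_real]
      exact mul_le_of_le_one_right (norm_nonneg _) (hsg1 _)
    have h1 := h G (hG0.indicator hs)
    have h2 : ∀ x, F x * G x = ((s.indicator (fun x => p x * ‖F x‖) x : ℝ) : ℂ) := by
      intro x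
      by_cases hx : x ∈ s
      · simp only [hG, Set.indicator_of_mem hx]
        rw [mul_left_comm, hsg]
        push_cast
        rfl
      · simp [hG, hx]
    have h3 : ∀ x, p x * ‖G x‖ ≤ s.indicator (fun x => p x * p x) x := by
      intro x
      by_cases hx : x ∈ s
      · simp only [hG, Set.indicator_of_mem hx]
        rw [norm_mul, Complex.norm_real, Real.norm_of_nonneg (hp0 x).le]
        exact mul_le_mul_of_nonneg_left (mul_le_of_le_one_right (hp0 x).le (hsg1 _)) (hp0 x).le
      · simp [hG, hx]
    have h4 : ∫ x, F x * G x ∂μ = ((∫ x in s, p x * ‖F x‖ ∂μ : ℝ) : ℂ) := by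
      simp_rw [h2]
      rw [integral_complex_ofReal, integral_indicator hs]
    have h5 : ∫ x, p x * ‖G x‖ ∂μ ≤ ∫ x in s, p x * p x ∂μ := by
      rw [← integral_indicator hs]
      exact integral_mono_of_nonneg
        (Eventually.of_forall fun x => mul_nonneg (hp0 x).le (norm_nonneg _))
        ((hp.integrable_mul hp).indicator hs) (Eventually.of_forall h3)
    rw [h4, Complex.norm_real] at h1
    rw [integral_const_mul]
    exact (le_abs_self _).trans (h1.trans (mul_le_mul_of_nonneg_left h5 hM))
  filter_upwards [hle] with x hx
  refine le_of_mul_le_mul_left ?_ (hp0 x)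
  linarith

namespace TemperedDistribution

open SchwartzMap

variable {E : Type*} [NormedAddCommGroup E] [InnerProductSpace ℝ E] [FiniteDimensional ℝ E]
  [MeasurableSpace E] [BorelSpace E]

/-- A tempered distribution that is bounded for the `L¹` norm is a bounded function. -/
theorem exists_Lp_top_of_norm_apply_le (a : 𝓢'(E, ℂ)) {M : ℝ} (hM : 0 ≤ M)
    (h : ∀ v : 𝓢(E, ℂ), ‖a v‖ ≤ M * ∫ x, ‖v x‖) :
    ∃ f : Lp ℂ ∞ (volume : Measure E), Lp.toTemperedDistribution f = a ∧ ‖f‖ ≤ M := by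
  -- An exponent above the dimension makes `p` integrable, and `p ≤ 1` then puts it in `L²`. The
  -- weight replaces `L¹` duality by the Riesz representation theorem in `L²`.
  set r : ℝ := Module.finrank ℝ E + 1 with hr
  set p : E → ℝ := fun x => (1 + ‖x‖ ^ 2) ^ (-r / 2) with hp
  set q : E → ℝ := fun x => (1 + ‖x‖ ^ 2) ^ (r / 2) with hq
  have hbase : ∀ x : E, 0 < 1 + ‖x‖ ^ 2 := fun x => by positivity
  have hp0 : ∀ x, 0 < p x := fun x => Real.rpow_pos_of_pos (hbase x) _
  have hp1 : ∀ x, p x ≤ 1 := fun x =>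
    Real.rpow_le_one_of_one_le_of_nonpos (by nlinarith [sq_nonneg ‖x‖])
      (by have : 0 ≤ r := by positivity
          linarith)
  have hpq : ∀ x, p x * q x = 1 := fun x => by
    rw [hp, hq, ← Real.rpow_add (hbase x)]
    ring_nf
    exact Real.rpow_zero _
  have hpt : (fun x => (p x : ℂ)).HasTemperateGrowth :=
    Function.Complex.hasTemperateGrowth_ofReal.comp
      (Function.hasTemperateGrowth_one_add_norm_sq_rpow E (-r / 2))
  have hqt : (fun x => (q x : ℂ)).HasTemperateGrowth :=
    Function.Complex.hasTemperateGrowth_ofReal.comp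
      (Function.hasTemperateGrowth_one_add_norm_sq_rpow E (r / 2))
  have hpi : Integrable p := integrable_rpow_neg_one_add_norm_sq (by simp [hr])
  have hpL : MemLp p 2 (volume : Measure E) := by
    refine (memLp_two_iff_integrable_sq hpi.aestronglyMeasurable).2
      (hpi.mono' (hpi.aestronglyMeasurable.pow 2) (Eventually.of_forall fun x => ?_))
    rw [Real.norm_of_nonneg (sq_nonneg _), sq]
    exact mul_le_of_le_one_left (hp0 x).le (hp1 x)
  let P : Lp ℂ 2 (volume : Measure E) →L[ℂ] Lp ℂ 1 (volume : Measure E) :=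
    (ContinuousLinearMap.mul ℂ ℂ).holderL volume 2 2 1 (hpL.ofReal (K := ℂ)).toLp
  have hP : ∀ G : Lp ℂ 2 (volume : Measure E), ‖P G‖ = ∫ x, p x * ‖G x‖ := by
    intro G
    rw [L1.norm_eq_integral_norm]
    refine integral_congr_ae ?_
    filter_upwards [(ContinuousLinearMap.mul ℂ ℂ).coeFn_holder (r := 1)
      (hpL.ofReal (K := ℂ)).toLp G, (hpL.ofReal (K := ℂ)).coeFn_toLp] with x hx1 hx2
    change ‖(ContinuousLinearMap.holder 1 (ContinuousLinearMap.mul ℂ ℂ) _ G) x‖ = _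
    rw [hx1, hx2]
    simp [abs_of_pos (hp0 x)]
  -- The functional `v ↦ ⟨a, p v⟩` is bounded by `M ∫ p |v|`, hence extends continuously to `L²`.
  let L : 𝓢(E, ℂ) →ₗ[ℂ] ℂ :=
    { toFun := fun v => a (SchwartzMap.smulLeftCLM ℂ (fun x => (p x : ℂ)) v)
      map_add' := fun v w => by rw [map_add, map_add]
      map_smul' := fun c v => by rw [map_smul, map_smul, RingHom.id_apply] }
  have hL : ∀ v, ‖L v‖ ≤ M * ‖P (v.toLp 2)‖ := by
    intro v
    refine (h _).trans (le_of_eq ?_)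
    rw [hP]
    congr 1
    refine integral_congr_ae ?_
    filter_upwards [v.coeFn_toLp 2 volume] with x hx
    rw [hx, SchwartzMap.smulLeftCLM_apply_apply hpt]
    simp [abs_of_pos (hp0 x)]
  have hdense := denseRange_toLpCLM (E := E) (F := ℂ) (p := 2) (μ := volume) (by simp)
  let e : 𝓢(E, ℂ) →ₗ[ℂ] Lp ℂ 2 (volume : Measure E) := (toLpCLM ℂ ℂ 2 volume).toLinearMap
  have hde : DenseRange e := hdense
  have hLC : ∀ v, ‖L v‖ ≤ (M * ‖P‖) * ‖e v‖ := fun v => by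
    refine (hL v).trans ?_
    rw [mul_assoc]
    gcongr
    exact P.le_opNorm _
  let Φ : Lp ℂ 2 (volume : Measure E) →L[ℂ] ℂ := L.extendOfNorm e
  have hΦ : ∀ v, Φ (v.toLp 2) = L v := LinearMap.extendOfNorm_eq hde ⟨_, hLC⟩
  have hΦP : ∀ G, ‖Φ G‖ ≤ M * ‖P G‖ := by
    intro G
    refine hde.induction_on G (isClosed_le Φ.continuous.norm
      (continuous_const.mul P.continuous.norm)) fun v => ?_
    exact (congrArg norm (hΦ v)).trans_le (hL v)
  let f₀ : Lp ℂ 2 (volume : Measure E) := (InnerProductSpace.toDual ℂ _).symm Φ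
  set F : E → ℂ := fun x => (starRingEnd ℂ) (f₀ x) with hFdef
  have hF : MemLp F 2 volume := (Lp.memLp f₀).star
  have hΦF : ∀ (G : E → ℂ) (hG : MemLp G 2 volume), Φ hG.toLp = ∫ x, F x * G x := by
    intro G hG
    have h1 : Φ hG.toLp = inner ℂ f₀ hG.toLp := (InnerProductSpace.toDual_symm_apply).symm
    rw [h1, L2.inner_def]
    refine integral_congr_ae ?_
    filter_upwards [hG.coeFn_toLp] with x hx
    rw [hx, RCLike.inner_apply, mul_comm]
  have hbound : ∀ᵐ x, ‖F x‖ ≤ M * p x := by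
    refine ae_norm_le_of_norm_integral_mul_le hF hpL hp0 hM fun G hG => ?_
    rw [← hΦF G hG]
    refine (hΦP _).trans (le_of_eq ?_)
    rw [hP]
    congr 1
    refine integral_congr_ae ?_
    filter_upwards [hG.coeFn_toLp] with x hx
    rw [hx]
  -- Undoing the weight: since `F` represents `p a`, the density of `a` is `q F` with `q = 1 / p`.
  have hfb : ∀ᵐ x, ‖(q x : ℂ) * F x‖ ≤ M := by
    filter_upwards [hbound] with x hx
    have hq0 : 0 < q x := Real.rpow_pos_of_pos (hbase x) _
    rw [norm_mul, Complex.norm_real, Real.norm_of_nonneg hq0.le]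
    calc q x * ‖F x‖ ≤ q x * (M * p x) := by gcongr
      _ = M * (p x * q x) := by ring
      _ = M := by rw [hpq, mul_one]
  have hfm : MemLp (fun x => (q x : ℂ) * F x) ∞ volume :=
    memLp_top_of_bound (hqt.1.continuous.aestronglyMeasurable.mul hF.aestronglyMeasurable) M hfb
  refine ⟨hfm.toLp, ?_, ?_⟩
  · ext v
    have h1 : a v = L (SchwartzMap.smulLeftCLM ℂ (fun x => (q x : ℂ)) v) := by
      change a v = a _
      congr 1
      ext x
      rw [SchwartzMap.smulLeftCLM_apply_apply hpt, SchwartzMap.smulLeftCLM_apply_apply hqt, smul_eq_mul, smul_eq_mul,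
        ← mul_assoc, ← Complex.ofReal_mul, hpq, Complex.ofReal_one, one_mul]
    rw [h1, ← hΦ]
    refine Eq.trans ?_ (hΦF _ (SchwartzMap.memLp _ 2 volume)).symm
    rw [Lp.toTemperedDistribution_apply]
    refine integral_congr_ae ?_
    filter_upwards [hfm.coeFn_toLp] with x hx
    rw [hx, SchwartzMap.smulLeftCLM_apply_apply hqt, smul_eq_mul, smul_eq_mul]
    ring
  · rw [Lp.norm_toLp, eLpNorm_exponent_top]
    exact ENNReal.toReal_le_of_le_ofReal hM (eLpNormEssSup_le_of_ae_bound hfb)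

end TemperedDistribution

/-! ### Passing between the two normalizations of the Fourier transform -/

section Normalization

open SchwartzMap TemperedDistribution

variable {n : ℕ}

/-- Composition of a Schwartz function with the dilation by `c`. -/
noncomputable def dilate (n : ℕ) (c : ℝ) (hc : c ≠ 0) : 𝓢(Rn n, ℂ) →L[ℂ] 𝓢(Rn n, ℂ) :=
  compCLMOfContinuousLinearEquiv ℂ (dilation n c hc)

theorem dilate_apply (c : ℝ) (hc : c ≠ 0) (v : 𝓢(Rn n, ℂ)) (x : Rn n) :
    dilate n c hc v x = v (c • x) := rfl

theorem schwartzF_eq (u : 𝓢(Rn n, ℂ)) :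
    schwartzF n u = dilate n (2 * Real.pi)⁻¹ (inv_ne_zero Real.two_pi_pos.ne') (𝓕 u) := rfl

/-- Moving the dilation outside `𝓕⁻` gives `schwartzF` and `schwartzFInv` the same dilation, which
can then be transferred from their product to the symbol. -/
theorem schwartzFInv_eq (w : 𝓢(Rn n, ℂ)) :
    schwartzFInv n w = (((2 * Real.pi) ^ n)⁻¹ : ℂ) •
      dilate n (2 * Real.pi)⁻¹ (inv_ne_zero Real.two_pi_pos.ne') (𝓕⁻ w) := by
  ext x
  rw [schwartzFInv_apply, smul_apply, dilate_apply, fourierInv_coe, Real.fourierInv_eq',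
    smul_eq_mul]
  congr 1
  · push_cast
    rfl
  refine integral_congr_ae (Eventually.of_forall fun ξ => ?_)
  simp only [smul_eq_mul, inner_smul_right]
  rw [mul_comm, real_inner_comm ξ x]
  have hp : (Real.pi : ℂ) ≠ 0 := by exact_mod_cast Real.pi_ne_zero
  congr 2
  push_cast
  field_simp

/-- The symbol `(2π)⁻ⁿ a(·/2π)`-dual of `a`, for which the multiplier operator is
`𝓕⁻ b 𝓕` with Mathlib's normalization of the Fourier transform. -/
noncomputable def rescale (a : 𝓢'(Rn n, ℂ)) : 𝓢'(Rn n, ℂ) :=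
  (((2 * Real.pi) ^ n)⁻¹ : ℂ) • PointwiseConvergenceCLM.precomp ℂ
    (dilate n (2 * Real.pi)⁻¹ (inv_ne_zero Real.two_pi_pos.ne')) a

theorem rescale_apply (a : 𝓢'(Rn n, ℂ)) (v : 𝓢(Rn n, ℂ)) :
    rescale a v = (((2 * Real.pi) ^ n)⁻¹ : ℂ) *
      a (dilate n (2 * Real.pi)⁻¹ (inv_ne_zero Real.two_pi_pos.ne') v) := rfl

theorem fourierMult_apply (a : 𝓢'(Rn n, ℂ)) (u w : 𝓢(Rn n, ℂ)) :
    fourierMult a u w = rescale a (SchwartzMap.prod (𝓕 u) (𝓕⁻ w)) := by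
  have h1 : fourierMult a u w =
      a (SchwartzMap.smulLeftCLM ℂ (schwartzF n u) (schwartzFInv n w)) := rfl
  rw [h1, rescale_apply, ← smul_eq_mul, ← map_smul]
  congr 1
  ext ξ
  rw [SchwartzMap.smulLeftCLM_apply_apply (schwartzF n u).hasTemperateGrowth, schwartzFInv_eq,
    schwartzF_eq]
  simp only [smul_apply, dilate_apply, pairing_apply_apply, smul_eq_mul,
    ContinuousLinearMap.mul_apply']
  ring

theorem apply_eq_rescale_apply (a : 𝓢'(Rn n, ℂ)) (v : 𝓢(Rn n, ℂ)) :
    a v = ((2 * Real.pi) ^ n : ℂ) *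
      rescale a (dilate n (2 * Real.pi) Real.two_pi_pos.ne' v) := by
  have h : dilate n (2 * Real.pi)⁻¹ (inv_ne_zero Real.two_pi_pos.ne')
      (dilate n (2 * Real.pi) Real.two_pi_pos.ne' v) = v := by
    ext x
    rw [dilate_apply, dilate_apply, smul_inv_smul₀ Real.two_pi_pos.ne']
  have hp : ((2 * Real.pi) ^ n : ℂ) ≠ 0 := by
    exact_mod_cast (pow_pos Real.two_pi_pos n).ne'
  rw [rescale_apply, h, mul_inv_cancel_left₀ hp]

/-- This Jacobian cancels the factor `(2π) ^ n` of `apply_eq_rescale_apply`, so the normalization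
does not affect the constant `1`. -/
theorem integral_norm_dilate (v : 𝓢(Rn n, ℂ)) :
    ∫ x, ‖dilate n (2 * Real.pi) Real.two_pi_pos.ne' v x‖ =
      ((2 * Real.pi) ^ n)⁻¹ * ∫ x, ‖v x‖ := by
  have := Measure.integral_comp_smul_of_nonneg (volume : Measure (Rn n)) (fun x => ‖v x‖)
    (2 * Real.pi) (hR := Real.two_pi_pos.le)
  rwa [finrank_euclideanSpace_fin] at this

end Normalization

/-! ### The multiplier theorem and its sharpness -/

namespace BanachFunctionNorm

open SchwartzMap TemperedDistribution

variable {n : ℕ} {X : BanachFunctionNorm n}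

theorem norm_schwartz_ne_zero {u : 𝓢(Rn n, ℂ)} (hu : u ≠ 0) : X.norm u ≠ 0 := by
  rw [ne_eq, X.norm_eq_zero_iff u.continuous.aestronglyMeasurable]
  intro h
  refine hu (DFunLike.coe_injective ?_)
  exact (Continuous.ae_eq_iff_eq volume u.continuous continuous_const).1 h

theorem distNorm_fourierMult_le (a : 𝓢'(Rn n, ℂ)) {u : 𝓢(Rn n, ℂ)} (hu : u ≠ 0)
    (hu' : X.norm u < ∞) : X.distNorm (fourierMult a u) ≤ X.multNorm a * X.norm u := by
  rw [← ENNReal.div_le_iff (norm_schwartz_ne_zero hu) hu'.ne]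
  exact le_iSup_of_le u (le_iSup₂_of_le hu hu' le_rfl)

theorem WeakDoubling.exists_Lp_top (hX : X.WeakDoubling) {a : 𝓢'(Rn n, ℂ)}
    (ha : X.IsFourierMultiplier a) :
    ∃ f : Lp ℂ ∞ (volume : Measure (Rn n)),
      Lp.toTemperedDistribution f = a ∧ ‖f‖ₑ ≤ X.multNorm a := by
  obtain ⟨M, hM⟩ : ∃ M : ℝ≥0, (M : ℝ≥0∞) = X.multNorm a := ⟨_, ENNReal.coe_toNNReal ha.ne⟩
  have hb : ∀ u : 𝓢(Rn n, ℂ), u ≠ 0 → X.norm u < ∞ →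
      X.norm (multFun (rescale a) u) ≤ M * X.norm u := by
    intro u hu hu'
    rw [hM]
    refine le_trans (X.norm_le_distNorm (continuous_multFun _ u) fun w => ?_)
      (distNorm_fourierMult_le a hu hu')
    rw [fourierMult_apply, apply_prod_fourier_fourierInv]
  obtain ⟨f, hf, hfM⟩ := exists_Lp_top_of_norm_apply_le a M.coe_nonneg fun v => by
    have h1 := hX.norm_apply_le hb (dilate n (2 * Real.pi) Real.two_pi_pos.ne' v)
    have hp : (0 : ℝ) < (2 * Real.pi) ^ n := pow_pos Real.two_pi_pos n
    have hpn : ‖((2 * Real.pi) ^ n : ℂ)‖ = (2 * Real.pi) ^ n := by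
      rw [norm_pow, norm_mul, Complex.norm_real, Real.norm_of_nonneg Real.pi_pos.le]
      norm_num
    rw [integral_norm_dilate] at h1
    rw [apply_eq_rescale_apply, norm_mul, hpn]
    calc _ ≤ (2 * Real.pi) ^ n * (M * (((2 * Real.pi) ^ n)⁻¹ * ∫ x, ‖v x‖)) := by gcongr
      _ = _ := by field_simp
  refine ⟨f, hf, ?_⟩
  rw [← hM, ← ofReal_norm, ← ENNReal.ofReal_coe_nnreal]
  exact ENNReal.ofReal_le_ofReal hfM

/-- The constant function `1` as a bounded function. -/
noncomputable def oneLpTop (n : ℕ) : Lp ℂ ∞ (volume : Measure (Rn n)) :=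
  (memLp_top_const (1 : ℂ)).toLp

theorem enorm_oneLpTop (n : ℕ) : ‖oneLpTop n‖ₑ = 1 := by
  rw [oneLpTop, Lp.enorm_toLp, eLpNorm_const _ (by simp) (NeZero.ne _)]
  simp

theorem oneLpTop_apply (v : 𝓢(Rn n, ℂ)) :
    Lp.toTemperedDistribution (oneLpTop n) v = ∫ x, v x := by
  rw [Lp.toTemperedDistribution_apply]
  refine integral_congr_ae ?_
  filter_upwards [(memLp_top_const (μ := (volume : Measure (Rn n))) (1 : ℂ)).coeFn_toLp] with x hx
  rw [oneLpTop, hx, smul_eq_mul, mul_one]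

theorem fourierMult_oneLpTop_apply (u w : 𝓢(Rn n, ℂ)) :
    fourierMult (Lp.toTemperedDistribution (oneLpTop n)) u w = ∫ x, u x * w x := by
  have hp : ((2 * Real.pi) ^ n : ℂ) ≠ 0 := by
    exact_mod_cast (pow_pos Real.two_pi_pos n).ne'
  have h : ∀ v : 𝓢(Rn n, ℂ), rescale (Lp.toTemperedDistribution (oneLpTop n)) v = ∫ x, v x := by
    intro v
    have h1 := Measure.integral_comp_inv_smul_of_nonneg (volume : Measure (Rn n)) v
      (R := 2 * Real.pi) Real.two_pi_pos.le
    rw [rescale_apply, oneLpTop_apply]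
    simp only [dilate_apply]
    rw [h1, finrank_euclideanSpace_fin, Complex.real_smul]
    push_cast
    rw [inv_mul_cancel_left₀ hp]
  rw [fourierMult_apply, h]
  simp only [pairing_apply_apply, ContinuousLinearMap.mul_apply']
  -- The multiplication formula `∫ 𝓕u · g = ∫ u · 𝓕g` with `g = 𝓕⁻ w`.
  rw [integral_fourier_mul_eq, FourierTransform.fourier_fourierInv_eq]

theorem multNorm_oneLpTop_le : X.multNorm (Lp.toTemperedDistribution (oneLpTop n)) ≤ 1 := by
  refine iSup_le fun u => iSup₂_le fun hu hu' => ENNReal.div_le_of_le_mul ?_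
  rw [one_mul]
  exact iInf₂_le_of_le u ⟨u.continuous.locallyIntegrable, fun w _ =>
    fourierMult_oneLpTop_apply u w⟩ le_rfl

end BanachFunctionNorm

theorem theorem1p2 (n : ℕ) (hn : 1 ≤ n) (X : BanachFunctionNorm n) (hX : X.WeakDoubling) :
    (∀ a : 𝓢'(Rn n, ℂ), X.IsFourierMultiplier a →
      ∃ f : Lp ℂ ∞ (volume : Measure (Rn n)),
        Lp.toTemperedDistribution f = a ∧ ‖f‖ₑ ≤ X.multNorm a) ∧
    (∀ D : ℝ≥0,
      (∀ a : 𝓢'(Rn n, ℂ), X.IsFourierMultiplier a →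
        ∀ f : Lp ℂ ∞ (volume : Measure (Rn n)),
          Lp.toTemperedDistribution f = a → ‖f‖ₑ ≤ (D : ℝ≥0∞) * X.multNorm a) →
      1 ≤ D) := by
  refine ⟨fun a ha => hX.exists_Lp_top ha, fun D hD => ?_⟩
  -- The symbol `1` has sup norm `1` and multiplier norm at most `1`, which forces `1 ≤ D`.
  have h1 := hD (Lp.toTemperedDistribution (BanachFunctionNorm.oneLpTop n))
    (BanachFunctionNorm.multNorm_oneLpTop_le.trans_lt ENNReal.one_lt_top)
    (BanachFunctionNorm.oneLpTop n) rfl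
  rw [BanachFunctionNorm.enorm_oneLpTop] at h1
  have h2 : (1 : ℝ≥0∞) ≤ D := by
    refine h1.trans ?_
    calc (D : ℝ≥0∞) * X.multNorm _ ≤ D * 1 := by
          gcongr
          exact BanachFunctionNorm.multNorm_oneLpTop_le
      _ = D := mul_one _
  exact_mod_cast h2
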